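/- A \emph{skew partition} $\beta/\gamma$ consists of partitions $\gamma\subseteq\beta$ with the same fixed number $\ell$ of parts, $\beta=(\beta_1\ge\dots\ge\beta_\ell\ge 0)$, $\gamma=(\gamma_1\ge\dots\ge\gamma_\ell\ge 0)$, $\gamma_i\le\beta_i$; zero parts are allowed. Its cells are the pairs $(i,j)$ with $\gamma_i<j\le\beta_i$ (row $i$, column $j$), and the content of $(i,j)$ is $j-i$. A semistandard tableau of shape $\beta/\gamma$ with entries in $\{1,\dots,n\}$ is a filling of the cells with $T(i,j)\le T(i,j')$ for $j<j'$ and $T(i,j)<T(i',j)$ for $i<i'$. Let $\boldsymbol\beta/\boldsymbol\gamma=(\beta^{(1)}/\gamma^{(1)},\dots,\beta^{(k)}/\gamma^{(k)})$ be a tuple of skew partitions and let $T=(T^{(1)},\dots,T^{(k)})$ be a tuple of semistandard tableaux of these shapes. A \emph{triple} consists of a cell $v$ of the $p$-th shape and of $u=(r,j)$, $w=(r,j+1)$ in a row $r$ of the $q$-th shape, where $p<q$, $\gamma^{(q)}_r\le j\le\beta^{(q)}_r$, and $v$, $w$ have the same content. Let $b$ be the entry of $v$, $a$ the entry of $u$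 ($a=0$ if $u$ is not a cell of the $q$-th shape) and $c$ the entry of $w$ ($c=\infty$ if $w$ is not a cell of the $q$-th shape). It is a coinversion triple if $a\le b\le c$, and $\mathrm{coinv}(T)$ is the number of coinversion triples. The coinversion LLT polynomial is $$\mathcal L_{\boldsymbol\beta/\boldsymbol\gamma}(X_n;t)=\sum_{T}t^{\mathrm{coinv}(T)}x^T ,\qquad X_n=\{x_1,\dots,x_n\},$$ the sum being over all tuples $T$ of semistandard tableaux of shape $\boldsymbol\beta/\boldsymbol\gamma$ with entries in $\{1,\dots,n\}$. Now let $k=2$ and $(\boldsymbol\beta/\boldsymbol\gamma)_{swap}=(\beta^{(2)}/\gamma^{(2)},\beta^{(1)}/\gamma^{(1)})$. On the top boundary put a blue path in every column $\beta^{(1)}_m-m+1$ and a red path in every column $\beta^{(2)}_m-m+1$; on the bottom boundary put a blue path in every column $\gamma^{(1)}_m-m+1$ and a red path in every column $\gamma^{(2)}_m-m+1$. The \emph{beads} are the paths in whose column there is no path of the other color on the same boundary; they form a top row and a bottom row, ordered by column. The label of a bead is the number of paths of both colors on the same boundary in columns strictly to its right. A \emph{matching} is a set of arcs, each joining two beads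 of different colors in the same row or two beads of the same color in different rows, such that every bead lies on exactly one arc; it is \emph{non-crossing} if the arcs can be drawn in the strip between the two rows without crossing. The weight $w(a)$ of an arc $a$ is: - $t^{(j-i)/2}$ if $a$ joins a blue bead labelled $i$ in the top row and a blue bead labelled $j$ in the bottom row; - $t^{(j-i)/2}$ if $a$ joins a red bead labelled $j$ in the top row and a red bead labelled $i$ in the bottom row; - $t^{(j-i+1)/2}$ (resp. $t^{(j-i-1)/2}$) if $a$ joins, in the top row, a red bead labelled $j$ and a blue bead labelled $i$ to its right (resp. to its left); - $t^{(j-i+1)/2}$ (resp. $t^{(j-i-1)/2}$) if $a$ joins, in the bottom row, a red bead labelled $i$ and a blue bead labelled $j$ to its right (resp. to its left). \textbf{Theorem.} If there is exactly one non-crossing matching $M$ of the beads of $\boldsymbol\beta/\boldsymbol\gamma=(\beta^{(1)}/\gamma^{(1)},\beta^{(2)}/\gamma^{(2)})$, then for every $n\ge 0$ the polynomials $\mathcal L_{\boldsymbol\beta/\boldsymbol\gamma}(X_n;t)$ and $\mathcal L_{(\boldsymbol\beta/\boldsymbol\gamma)_{swap}}(X_n;t)$ are equal up to an integral power of $t$.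 Explicitly, each weight $w(a)$, $a\in M$, is an integral power of $t$, and $$\mathcal L_{\boldsymbol\beta/\boldsymbol\gamma}(X_n;t)=\Bigl(\prod_{a\in M}w(a)\Bigr)\,\mathcal L_{(\boldsymbol\beta/\boldsymbol\gamma)_{swap}}(X_n;t).$$ -/

import Mathlib

/-- A skew partition `β/γ`: two partitions `γ ⊆ β` with the same fixed number `len` of parts
(parts equal to zero are allowed).  Rows are indexed from `0`: the row `i : Fin len` is the row
with number `i + 1` in the usual indexing. -/
structure SkewPartition where
  len : ℕ
  outer : Fin len → ℕ
  inner : Fin len → ℕ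
  outer_antitone : Antitone outer
  inner_antitone : Antitone inner
  inner_le_outer : ∀ i, inner i ≤ outer i

namespace SkewPartition

/-- The cells of `β/γ`: in row `i` the columns `j` with `γ_i < j ≤ β_i`
(columns are numbered from `1`). -/
abbrev Cell (S : SkewPartition) : Type :=
  (i : Fin S.len) × Finset.Ioc (S.inner i) (S.outer i)

/-- The content of the cell in row `i` (indexed from `0`) and column `j` (indexed from `1`). -/
def content {m : ℕ} (i : Fin m) (j : ℕ) : ℤ := (j : ℤ) - ((i : ℤ) + 1)

/-- Semistandard fillings by the alphabet `1, …, n`, French convention: weakly increasing along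
rows, strictly increasing up columns.  The element `x : Fin n` stands for the letter `x + 1`. -/
def IsSemistandard (S : SkewPartition) {n : ℕ} (T : S.Cell → Fin n) : Prop :=
  (∀ c d : S.Cell, c.1 = d.1 → (c.2 : ℕ) ≤ (d.2 : ℕ) → T c ≤ T d) ∧
  (∀ c d : S.Cell, c.1 < d.1 → (c.2 : ℕ) = (d.2 : ℕ) → T c < T d)

instance (S : SkewPartition) {n : ℕ} (T : S.Cell → Fin n) : Decidable (S.IsSemistandard T) := by
  unfold IsSemistandard; infer_instance

/-- `SSYT(β/γ)` with entries in `1, …, n`. -/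
abbrev Tableau (S : SkewPartition) (n : ℕ) : Type :=
  {T : S.Cell → Fin n // S.IsSemistandard T}

/-- The letter in the cell `(r, j)`, with the value `0` if the cell is not in the shape. -/
def entryOrZero {S : SkewPartition} {n : ℕ} (T : S.Tableau n) (r : Fin S.len) (j : ℕ) : ℕ∞ :=
  if h : j ∈ Finset.Ioc (S.inner r) (S.outer r) then (((T.1 ⟨r, j, h⟩ : ℕ) + 1 : ℕ) : ℕ∞) else 0

/-- The letter in the cell `(r, j)`, with the value `∞` if the cell is not in the shape. -/
def entryOrTop {S : SkewPartition} {n : ℕ} (T : S.Tableau n) (r : Fin S.len) (j : ℕ) : ℕ∞ :=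
  if h : j ∈ Finset.Ioc (S.inner r) (S.outer r) then (((T.1 ⟨r, j, h⟩ : ℕ) + 1 : ℕ) : ℕ∞) else ⊤

end SkewPartition

section LLT

variable {k : ℕ} (S : Fin k → SkewPartition)

/-- `SSYT` of a tuple of skew partitions: one tableau for each shape. -/
abbrev TableauTuple (n : ℕ) : Type := (p : Fin k) → (S p).Tableau n

/-- The data `(u, v, w)` of a possible triple: shapes `p`, `q`, a cell `v` of the shape `p`, a row
`r` of the shape `q` and a column `j` with `γ_r ≤ j ≤ β_r`.  Then `u = (r, j)`, `w = (r, j + 1)`: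
both lie between the cells `(r, γ_r)` and `(r, β_r + 1)`, inclusive. -/
abbrev TripleData : Type :=
  (p : Fin k) × (q : Fin k) × (S p).Cell ×
    ((r : Fin (S q).len) × Finset.Icc ((S q).inner r) ((S q).outer r))

variable {S}

/-- The shape of `w` comes later than that of `v`, and `v`, `w` are on the same content line. -/
def IsTriple : TripleData S → Prop
  | ⟨p, q, v, ⟨r, j⟩⟩ =>
    p < q ∧ SkewPartition.content v.1 (v.2 : ℕ) = SkewPartition.content r ((j : ℕ) + 1)

/-- `a ≤ b ≤ c` for the entries `a`, `b`, `c` of `u`, `v`, `w`, where `a = 0` and `c = ∞`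
for cells outside the shape. -/
def IsCoinversion {n : ℕ} (T : TableauTuple S n) : TripleData S → Prop
  | ⟨p, q, v, ⟨r, j⟩⟩ =>
    SkewPartition.entryOrZero (T q) r (j : ℕ) ≤ ((((T p).1 v : ℕ) + 1 : ℕ) : ℕ∞) ∧
      ((((T p).1 v : ℕ) + 1 : ℕ) : ℕ∞) ≤ SkewPartition.entryOrTop (T q) r ((j : ℕ) + 1)

open Classical in
/-- The number of coinversion triples of `T`. -/
noncomputable def coinv {n : ℕ} (T : TableauTuple S n) : ℕ :=
  (Finset.univ.filter fun x : TripleData S => IsTriple x ∧ IsCoinversion T x).card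

variable (S)

/-- The coinversion LLT polynomial `∑_T t^{coinv T} x^T` in the variables `x_1, …, x_n`, regarded
as a polynomial over the Laurent polynomials `ℤ[t, t⁻¹]`. -/
noncomputable def coinvLLT (n : ℕ) : MvPolynomial (Fin n) (LaurentPolynomial ℤ) :=
  ∑ T : TableauTuple S n,
    MvPolynomial.C (LaurentPolynomial.T (coinv T : ℤ)) *
      ∏ p : Fin k, ∏ c : (S p).Cell, MvPolynomial.X ((T p).1 c)

end LLT

/-- Equality up to an overall power of `t`. -/
def LLTEquivalent {n : ℕ} (F G : MvPolynomial (Fin n) (LaurentPolynomial ℤ)) : Prop :=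
  ∃ e : ℤ, F = MvPolynomial.C (LaurentPolynomial.T e) * G

/-- The two rows of beads (the top and the bottom boundary). -/
inductive BeadRow : Type
  | top
  | bottom
  deriving DecidableEq

/-- The paths of the first shape are blue, those of the second shape are red. -/
inductive BeadColor : Type
  | blue
  | red
  deriving DecidableEq

/-- A path end on the boundary: its row, its color, and its column in the lattice. -/
structure Bead : Type where
  row : BeadRow
  color : BeadColor
  col : ℤ
  deriving DecidableEq

namespace Bead

/-- The columns with a path of the shape `β/γ` on the given boundary: `β_m - m + 1` on the top and
`γ_m - m + 1` on the bottom, for `m = 1, …, ℓ` (here `m = i + 1`). -/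
def pathCols (S : SkewPartition) : BeadRow → Finset ℤ
  | .top => Finset.univ.image fun i : Fin S.len => (S.outer i : ℤ) - (i : ℤ)
  | .bottom => Finset.univ.image fun i : Fin S.len => (S.inner i : ℤ) - (i : ℤ)

/-- The beads of the pair `(S₁, S₂)`: the singleton paths on the two boundaries, that is, those
in whose column there is no path of the other color on the same boundary. -/
def IsBead (S₁ S₂ : SkewPartition) (b : Bead) : Prop :=
  match b.color with
  | .blue => b.col ∈ pathCols S₁ b.row ∧ b.col ∉ pathCols S₂ b.row
  | .red => b.col ∈ pathCols S₂ b.row ∧ b.col ∉ pathCols S₁ b.row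

/-- The label of a bead: the number of paths (of both colors) to its right on its boundary. -/
def label (S₁ S₂ : SkewPartition) (b : Bead) : ℤ :=
  (((pathCols S₁ b.row).filter fun i => b.col < i).card : ℤ) +
    (((pathCols S₂ b.row).filter fun i => b.col < i).card : ℤ)

/-- An arc joins beads of different colors in the same row,
or beads of the same color in different rows. -/
def ArcAllowed (b c : Bead) : Prop :=
  (b.row = c.row ∧ b.color ≠ c.color) ∨ (b.row ≠ c.row ∧ b.color = c.color)

/-- A matching: a set of allowed arcs such that every bead is on exactly one arc. -/
structure IsMatching (S₁ S₂ : SkewPartition) (M : Finset (Sym2 Bead)) : Prop where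
  isBead : ∀ a ∈ M, ∀ b ∈ a, IsBead S₁ S₂ b
  allowed : ∀ b c : Bead, s(b, c) ∈ M → ArcAllowed b c
  covers : ∀ b : Bead, IsBead S₁ S₂ b → ∃! a : Sym2 Bead, a ∈ M ∧ b ∈ a

/-- The order in which one meets the beads along the boundary of the strip between the two rows:
first the top row from left to right, then the bottom row from right to left. -/
def Before (b c : Bead) : Prop :=
  match b.row, c.row with
  | .top, .top => b.col < c.col
  | .top, .bottom => True
  | .bottom, .top => False
  | .bottom, .bottom => c.col < b.col

/-- Two arcs drawn in the strip between the two rows have to cross exactly if their endpoints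
alternate along the boundary of the strip. -/
def IsNonCrossing (M : Finset (Sym2 Bead)) : Prop :=
  ∀ b₁ b₂ c₁ c₂ : Bead, s(b₁, c₁) ∈ M → s(b₂, c₂) ∈ M →
    ¬ (Before b₁ b₂ ∧ Before b₂ c₁ ∧ Before c₁ c₂)

/-- The table of arc weights: the value is twice the exponent of `t`.  Only one of the two orders
of the endpoints of an arc is listed; the value for the other order is `0`. -/
def arcTable (S₁ S₂ : SkewPartition) (b c : Bead) : ℤ :=
  match b.row, b.color, c.row, c.color with
  -- blue bead `b` in the top row labelled `i`, blue bead `c` in the bottom row labelled `j`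
  | .top, .blue, .bottom, .blue => label S₁ S₂ c - label S₁ S₂ b
  -- red bead `b` in the top row labelled `j`, red bead `c` in the bottom row labelled `i`
  | .top, .red, .bottom, .red => label S₁ S₂ b - label S₁ S₂ c
  -- top row: red bead `b` labelled `j`, blue bead `c` labelled `i`
  | .top, .red, .top, .blue =>
    if b.col < c.col then label S₁ S₂ b - label S₁ S₂ c + 1 else label S₁ S₂ b - label S₁ S₂ c - 1
  -- bottom row: red bead `b` labelled `i`, blue bead `c` labelled `j`
  | .bottom, .red, .bottom, .blue =>
    if b.col < c.col then label S₁ S₂ c - label S₁ S₂ b + 1 else label S₁ S₂ c - label S₁ S₂ b - 1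
  | _, _, _, _ => 0

/-- Twice the exponent of `t` in the weight of an arc. -/
def twiceArcExponent (S₁ S₂ : SkewPartition) : Sym2 Bead → ℤ :=
  Sym2.lift ⟨fun b c => arcTable S₁ S₂ b c + arcTable S₁ S₂ c b, fun _ _ => add_comm _ _⟩

/-- The weight of an arc, an integral power of `t` if `twiceArcExponent` is even. -/
noncomputable def arcWeight (S₁ S₂ : SkewPartition) (a : Sym2 Bead) : LaurentPolynomial ℤ :=
  LaurentPolynomial.T (twiceArcExponent S₁ S₂ a / 2)

end Bead

/-!
The coinversion LLT polynomial of a pair of skew partitions is the partition function of a lattice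
model with blue and red paths. The transfer matrix of one row of this model commutes with a flip
operator, a lowering operator of `U_q(sl₂)` which recolors one path at a time. Columns with two
paths are not affected by a flip, so as a function of the coloring of the beads the partition
function, suitably rescaled, is annihilated by a `q`-lowering operator: it satisfies
`LoweringRelation`.

Orient blue paths upwards and red paths downwards, so that every bead is a source or a sink, and
every arc of a matching joins a source and a sink. Reading the beads along the boundary of the
strip, a non-crossing matching is unique only if no four beads are alternately sources and sinks,
that is, only if the sources form a cyclic interval. After a rotation, all sources come before all
sinks. In this situation the lowering relation determines the ratio of the values at the set of
sources and at its complement, which is a power of `q` up to sign, and complementation exchanges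
the two skew shapes. The exponent of this power is a sum over the beads, and it can be distributed
over the arcs of the matching.
-/

section LoweringRelation

open Finset

variable {α ι R : Type*} [LinearOrder ι] [CommRing R]

theorem sum_apply_card_filter_lt {M : Type*} [AddCommMonoid M] (f : ℕ → M) {pos : α → ι}
    {A : Finset α} (hpos : Set.InjOn pos A) :
    ∑ i ∈ A, f #{j ∈ A | pos i < pos j} = ∑ m ∈ range #A, f m := by
  classical
  induction A using Finset.induction_on_max_value pos generalizing f with
  | empty => simp
  | insert a s ha hmax ih =>
    have hlt : ∀ i ∈ s, pos i < pos a := fun i hi => (hmax i hi).lt_of_ne fun h =>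
      ha (hpos (mem_insert_of_mem hi) (mem_insert_self a s) h ▸ hi)
    have habove : ∀ i ∈ s, #{j ∈ insert a s | pos i < pos j} = #{j ∈ s | pos i < pos j} + 1 :=
      fun i hi => by rw [filter_insert, if_pos (hlt i hi), card_insert_of_notMem (by simp [ha])]
    have htop : #{j ∈ insert a s | pos a < pos j} = 0 := by
      simpa [filter_insert, filter_eq_empty_iff] using hmax
    rw [sum_insert ha, card_insert_of_notMem ha, sum_range_succ', htop, add_comm,
      ← ih (fun m => f (m + 1)) (hpos.mono (by simp))]
    exact congrArg (· + f 0) (sum_congr rfl fun i hi => by rw [habove i hi])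

variable [DecidableEq α]

theorem sum_powersetCard_succ_sum_mem {M : Type*} [AddCommMonoid M] (X : Finset α) (k : ℕ)
    (F : Finset α → α → M) :
    ∑ C ∈ X.powersetCard (k + 1), ∑ i ∈ C, F C i =
      ∑ C ∈ X.powersetCard k, ∑ i ∈ X \ C, F (insert i C) i := by
  rw [sum_sigma', sum_sigma']
  refine sum_bij' (fun p _ => ⟨p.1.erase p.2, p.2⟩) (fun p _ => ⟨insert p.2 p.1, p.2⟩)
    ?_ ?_ ?_ ?_ ?_ <;> rintro ⟨C, i⟩ h <;>
    simp only [mem_sigma, mem_powersetCard, mem_sdiff] at h ⊢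
  · exact ⟨⟨(erase_subset _ _).trans h.1.1, by rw [card_erase_of_mem h.2, h.1.2]; rfl⟩,
      h.1.1 h.2, notMem_erase _ _⟩
  · exact ⟨⟨insert_subset h.2.1 h.1.1, by rw [card_insert_of_notMem h.2.2, h.1.2]⟩,
      mem_insert_self _ _⟩
  · rw [insert_erase h.2]
  · rw [erase_insert h.2.2]
  · rw [insert_erase h.2]

theorem sum_powersetCard_succ_sum_erase {pos : α → ι} {Z : Finset α} (hpos : Set.InjOn pos Z)
    (q : R) (k : ℕ) (G : Finset α → R) :
    ∑ C ∈ Z.powersetCard (k + 1), ∑ i ∈ C,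
        q ^ #{j ∈ Z \ C | pos i < pos j} * G (C.erase i) =
      (∑ m ∈ range (#Z - k), q ^ m) * ∑ C ∈ Z.powersetCard k, G C := by
  rw [sum_powersetCard_succ_sum_mem Z k
    fun C i => q ^ #{j ∈ Z \ C | pos i < pos j} * G (C.erase i), mul_sum]
  refine sum_congr rfl fun C hC => ?_
  rw [mem_powersetCard] at hC
  rw [← hC.2, ← card_sdiff_of_subset hC.1,
    ← sum_apply_card_filter_lt (q ^ ·) (hpos.mono (by simp)), sum_mul]
  refine sum_congr rfl fun i hi => ?_
  rw [erase_insert (mem_sdiff.1 hi).2, sdiff_insert, filter_erase, erase_eq_of_notMem (by simp)]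

/-- The functional `H` on the `a`-element subsets of `s` is annihilated by the lowering operator of
`U_q(sl₂)`, acting on the tensor product of two-dimensional representations with factors indexed
by `s`, in the order given by `pos`: a subset stands for the set of factors in the lower state. -/
def LoweringRelation (q : R) (pos : α → ι) (s : Finset α) (a : ℕ) (H : Finset α → R) : Prop :=
  ∀ Q ⊆ s, #Q = a + 1 → ∑ i ∈ Q, q ^ #{j ∈ s \ Q | pos i < pos j} * H (Q.erase i) = 0

namespace LoweringRelation

variable {q : R} {pos : α → ι} {s X Y : Finset α} {a : ℕ} {H : Finset α → R}

theorem sum_add_sum_eq_zero (hH : LoweringRelation q pos (X ∪ Y) a H)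
    (hXY : ∀ x ∈ X, ∀ y ∈ Y, pos x < pos y) {C D : Finset α} (hC : C ⊆ X) (hD : D ⊆ Y)
    (hCD : #C + #D = a + 1) :
    ∑ i ∈ C, q ^ #{j ∈ X \ C | pos i < pos j} * (q ^ #(Y \ D) * H (C.erase i ∪ D)) +
      ∑ i ∈ D, q ^ #{j ∈ Y \ D | pos i < pos j} * H (C ∪ D.erase i) = 0 := by
  have hdisj : Disjoint X Y := disjoint_left.2 fun x hx hy => (hXY x hx x hy).false
  have hrel := hH (C ∪ D) (union_subset_union hC hD)
    (by rw [card_union_of_disjoint (hdisj.mono hC hD), hCD])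
  have hcompl : (X ∪ Y) \ (C ∪ D) = X \ C ∪ Y \ D := by
    ext x
    have := @hC x
    have := @hD x
    have : x ∈ X → x ∉ Y := fun h => disjoint_left.1 hdisj h
    simp only [mem_sdiff, mem_union]
    tauto
  have habove : ∀ i, #{j ∈ X \ C ∪ Y \ D | pos i < pos j} =
      #{j ∈ X \ C | pos i < pos j} + #{j ∈ Y \ D | pos i < pos j} := fun i => by
    rw [filter_union, card_union_of_disjoint
      (disjoint_filter_filter (hdisj.mono sdiff_subset sdiff_subset))]
  rw [sum_union (hdisj.mono hC hD), hcompl] at hrel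
  rw [← hrel]
  congr 1 <;> refine sum_congr rfl fun i hi => ?_
  · rw [habove, filter_true_of_mem (s := Y \ D)
      (fun j hj => hXY i (hC hi) j (mem_sdiff.1 hj).1), pow_add, mul_assoc,
      erase_union_distrib, erase_eq_of_notMem (s := D) fun h => (hXY i (hC hi) i (hD h)).false]
  · rw [habove, filter_false_of_mem (s := X \ C)
      (fun j hj => (hXY j (mem_sdiff.1 hj).1 i (hD hi)).not_gt), card_empty, zero_add,
      erase_union_distrib, erase_eq_of_notMem (s := C) fun h => (hXY i (hC h) i (hD hi)).false]

theorem qInt_mul_sum_powersetCard_succ {k l : ℕ}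
    (hH : LoweringRelation q pos (X ∪ Y) (k + l + 1) H) (hX : #X = k + l + 1)
    (hY : #Y = k + l + 1) (hXY : ∀ x ∈ X, ∀ y ∈ Y, pos x < pos y)
    (hpos : Set.InjOn pos ↑(X ∪ Y)) :
    (∑ m ∈ range (k + 1), q ^ m) *
        ∑ C ∈ X.powersetCard (k + 1), ∑ D ∈ Y.powersetCard l, H (C ∪ D) =
      -(q ^ k * ∑ m ∈ range (l + 1), q ^ m) *
        ∑ C ∈ X.powersetCard k, ∑ D ∈ Y.powersetCard (l + 1), H (C ∪ D) := by
  have hsum : ∑ C ∈ X.powersetCard (k + 1), ∑ D ∈ Y.powersetCard (l + 1),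
      (∑ i ∈ C, q ^ #{j ∈ X \ C | pos i < pos j} * (q ^ k * H (C.erase i ∪ D)) +
        ∑ i ∈ D, q ^ #{j ∈ Y \ D | pos i < pos j} * H (C ∪ D.erase i)) = 0 := by
    refine sum_eq_zero fun C hC => sum_eq_zero fun D hD => ?_
    rw [mem_powersetCard] at hC hD
    rw [← hH.sum_add_sum_eq_zero hXY hC.1 hD.1 (by lia), card_sdiff_of_subset hD.1, hY, hD.2,
      show k + l + 1 - (l + 1) = k by lia]
  have hleft : ∑ C ∈ X.powersetCard (k + 1), ∑ D ∈ Y.powersetCard (l + 1),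
      ∑ i ∈ C, q ^ #{j ∈ X \ C | pos i < pos j} * (q ^ k * H (C.erase i ∪ D)) =
      (∑ m ∈ range (l + 1), q ^ m) * (q ^ k *
        ∑ C ∈ X.powersetCard k, ∑ D ∈ Y.powersetCard (l + 1), H (C ∪ D)) := by
    have hshift := sum_powersetCard_succ_sum_erase (Z := X) (hpos.mono (by simp)) q k
      fun C => q ^ k * ∑ D ∈ Y.powersetCard (l + 1), H (C ∪ D)
    rw [hX, show k + l + 1 - k = l + 1 by lia, ← mul_sum] at hshift
    rw [← hshift]
    refine sum_congr rfl fun C _ => ?_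
    simp only [mul_sum]
    exact sum_comm
  have hright : ∀ C, ∑ D ∈ Y.powersetCard (l + 1),
      ∑ i ∈ D, q ^ #{j ∈ Y \ D | pos i < pos j} * H (C ∪ D.erase i) =
      (∑ m ∈ range (k + 1), q ^ m) * ∑ D ∈ Y.powersetCard l, H (C ∪ D) := fun C => by
    rw [sum_powersetCard_succ_sum_erase (hpos.mono (by simp)) q l fun D => H (C ∪ D), hY,
      show k + l + 1 - l = k + 1 by lia]
  simp only [sum_add_distrib, hleft, hright, ← mul_sum] at hsum
  linear_combination hsum

theorem prod_qInt_mul_sum_powersetCard (hH : LoweringRelation q pos (X ∪ Y) a H) (hX : #X = a)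
    (hY : #Y = a) (hXY : ∀ x ∈ X, ∀ y ∈ Y, pos x < pos y) (hpos : Set.InjOn pos ↑(X ∪ Y))
    {k l : ℕ} (hkl : k + l = a) :
    (∏ i ∈ range k, ∑ m ∈ range (i + 1), q ^ m) *
        ∑ C ∈ X.powersetCard k, ∑ D ∈ Y.powersetCard l, H (C ∪ D) =
      (-1) ^ k * q ^ k.choose 2 * (∏ i ∈ range k, ∑ m ∈ range (l + i + 1), q ^ m) * H Y := by
  induction k generalizing l with
  | zero =>
    obtain rfl : l = #Y := by lia
    simp
  | succ k ih =>
    obtain rfl : a = k + l + 1 := by lia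
    have hstep := hH.qInt_mul_sum_powersetCard_succ hX hY hXY hpos
    have hprev := ih (l := l + 1) (by lia)
    have hprod : ∏ i ∈ range (k + 1), ∑ m ∈ range (l + i + 1), q ^ m =
        (∏ i ∈ range k, ∑ m ∈ range (l + 1 + i + 1), q ^ m) * ∑ m ∈ range (l + 1), q ^ m := by
      rw [prod_range_succ']
      simp only [add_assoc, add_comm, add_left_comm, zero_add]
    rw [hprod, prod_range_succ, pow_succ, Nat.choose_succ_succ' k 1, Nat.choose_one_right, pow_add]
    linear_combination (∏ i ∈ range k, ∑ m ∈ range (i + 1), q ^ m) * hstep -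
      (q ^ k * ∑ m ∈ range (l + 1), q ^ m) * hprev

theorem apply_eq_of_forall_lt [IsDomain R] (hH : LoweringRelation q pos (X ∪ Y) a H)
    (hq : ∀ k, ∑ m ∈ range (k + 1), q ^ m ≠ 0) (hX : #X = a) (hY : #Y = a)
    (hXY : ∀ x ∈ X, ∀ y ∈ Y, pos x < pos y) (hpos : Set.InjOn pos ↑(X ∪ Y)) :
    H X = (-1) ^ a * q ^ a.choose 2 * H Y := by
  have hprod := hH.prod_qInt_mul_sum_powersetCard hX hY hXY hpos (add_zero a)
  have hXX : X.powersetCard a = {X} := by rw [← hX, powersetCard_self]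
  simp only [hXX, powersetCard_zero, sum_singleton, union_empty, zero_add] at hprod
  refine mul_left_cancel₀ (prod_ne_zero_iff.2 fun k (_ : k ∈ range a) => hq k) ?_
  linear_combination hprod

end LoweringRelation
end LoweringRelation

section Rotation

open Finset

variable {α ι R : Type*}

section LinearOrder

variable [LinearOrder ι] {pos : α → ι} {s P : Finset α}

/-- Four elements of `s` in increasing order lie alternately inside and outside `P`. -/
def HasAlternation (pos : α → ι) (s P : Finset α) : Prop :=
  ∃ i ∈ s, ∃ j ∈ s, ∃ k ∈ s, ∃ l ∈ s, pos i < pos j ∧ pos j < pos k ∧ pos k < pos l ∧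
    (i ∈ P ↔ j ∉ P) ∧ (j ∈ P ↔ k ∉ P) ∧ (k ∈ P ↔ l ∉ P)

/-- Twice the exponent of `q` which an arc from `p ∈ P` to `c ∉ P` contributes when all elements of
`P` are exchanged with their partners. -/
def arcShift (pos : α → ι) (s : Finset α) (p c : α) : ℤ :=
  (#{j ∈ s | pos p < pos j} : ℤ) - #{j ∈ s | pos c < pos j} + if pos p < pos c then -1 else 1

theorem hasAlternation_of_lt_of_lt (hpos : Set.InjOn pos s) {p n p' n₁ p₁ n₂ : α}
    (hp : p ∈ s ∧ p ∈ P) (hn : n ∈ s ∧ n ∉ P) (hp' : p' ∈ s ∧ p' ∈ P) (hpn : pos p < pos n)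
    (hnp' : pos n < pos p') (hn₁ : n₁ ∈ s ∧ n₁ ∉ P) (hp₁ : p₁ ∈ s ∧ p₁ ∈ P)
    (hn₂ : n₂ ∈ s ∧ n₂ ∉ P) (hnp₁ : pos n₁ < pos p₁) (hpn₂ : pos p₁ < pos n₂) :
    HasAlternation pos s P := by
  have hne : ∀ {x y}, x ∈ s ∧ x ∈ P → y ∈ s ∧ y ∉ P → pos x ≠ pos y := fun hx hy heq =>
    hy.2 (hpos hx.1 hy.1 heq ▸ hx.2)
  rcases (hne hp' hn₂).lt_or_gt with h | _
  · exact ⟨p, hp.1, n, hn.1, p', hp'.1, n₂, hn₂.1, hpn, hnp', h, by tauto⟩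
  rcases (hne hp hn₁).lt_or_gt with h' | h'
  · exact ⟨p, hp.1, n₁, hn₁.1, p₁, hp₁.1, n₂, hn₂.1, h', hnp₁, hpn₂, by tauto⟩
  · exact ⟨n₁, hn₁.1, p, hp.1, n, hn.1, p', hp'.1, h', hpn, hnp', by tauto⟩

end LinearOrder

variable [DecidableEq α]

/-- The lexicographic order in which the elements of `X` come after all others; for an initial
segment `X` this is a rotation. -/
def rotatedPos (X : Finset α) (pos : α → ι) (i : α) : Bool ×ₗ ι :=
  toLex (decide (i ∈ X), pos i)

variable {pos : α → ι} {X s P : Finset α} {i j : α} {a : ℕ}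

theorem injOn_rotatedPos (hpos : Set.InjOn pos s) : Set.InjOn (rotatedPos X pos) s :=
  fun _ hi _ hj h => hpos hi hj (congrArg (fun x => (ofLex x).2) h)

variable [LinearOrder ι]

theorem rotatedPos_lt_rotatedPos :
    rotatedPos X pos i < rotatedPos X pos j ↔
      i ∉ X ∧ j ∈ X ∨ (i ∈ X ↔ j ∈ X) ∧ pos i < pos j := by
  by_cases hi : i ∈ X <;> by_cases hj : j ∈ X <;> simp [rotatedPos, Prod.Lex.toLex_lt_toLex, hi, hj]

theorem card_filter_rotatedPos_lt (hX : ∀ x ∈ X, ∀ y ∈ s \ X, pos x < pos y) {A : Finset α}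
    (hA : A ⊆ s) (hi : i ∈ s) :
    (#{j ∈ A | rotatedPos X pos i < rotatedPos X pos j} : ℤ) =
      #{j ∈ A | pos i < pos j} + #(A ∩ X) - if i ∈ X then (#A : ℤ) else 0 := by
  have hpoint : ∀ j ∈ A, (if rotatedPos X pos i < rotatedPos X pos j then 1 else 0 : ℤ) =
      (if pos i < pos j then 1 else 0) + (if j ∈ X then 1 else 0) - if i ∈ X then 1 else 0 := by
    intro j hj
    have hij : i ∈ X → j ∉ X → pos i < pos j := fun h h' => hX i h j (mem_sdiff.2 ⟨hA hj, h'⟩)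
    have hji : j ∈ X → i ∉ X → pos j < pos i := fun h h' => hX j h i (mem_sdiff.2 ⟨hi, h'⟩)
    simp only [rotatedPos_lt_rotatedPos]
    by_cases hiX : i ∈ X <;> by_cases hjX : j ∈ X
    · simp [hiX, hjX]
    · simp [hiX, hjX, hij hiX hjX]
    · simp [hiX, hjX, (hji hjX hiX).not_gt]
    · simp [hiX, hjX]
  have hsum := sum_congr rfl hpoint
  rw [sum_sub_distrib, sum_add_distrib, sum_const] at hsum
  simpa only [sum_boole, sum_const, nsmul_eq_mul, mul_ite, mul_one, mul_zero,
    filter_mem_eq_inter] using hsum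

theorem LoweringRelation.rotate [CommRing R] {q : Rˣ} {H : Finset α → R}
    (hH : LoweringRelation (q : R) pos s a H) (hs : #s = 2 * a)
    (hX : ∀ x ∈ X, ∀ y ∈ s \ X, pos x < pos y) :
    LoweringRelation (q : R) (rotatedPos X pos) s a
      fun P => ↑(q ^ (-((a - 1) * #(P ∩ X) : ℤ))) * H P := by
  intro Q hQs hQ
  have hterm : ∀ i ∈ Q, (q : R) ^ #{j ∈ s \ Q | rotatedPos X pos i < rotatedPos X pos j} *
      (↑(q ^ (-((a - 1) * #(Q.erase i ∩ X) : ℤ))) * H (Q.erase i)) =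
      ↑(q ^ (#((s \ Q) ∩ X) - (a - 1) * #(Q ∩ X) : ℤ)) *
        ((q : R) ^ #{j ∈ s \ Q | pos i < pos j} * H (Q.erase i)) := by
    intro i hi
    have habove := card_filter_rotatedPos_lt hX (sdiff_subset (t := Q)) (hQs hi)
    have hcompl : (#(s \ Q) : ℤ) = a - 1 := by
      have := card_sdiff_add_card_eq_card hQs
      lia
    have hinter : (#(Q.erase i ∩ X) : ℤ) = #(Q ∩ X) - if i ∈ X then 1 else 0 := by
      rw [erase_inter]
      split_ifs with h
      · rw [cast_card_erase_of_mem (mem_inter.2 ⟨hi, h⟩)]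
      · rw [erase_eq_of_notMem (by simp [h]), sub_zero]
    simp only [← mul_assoc, ← Units.val_pow_eq_pow_val, ← Units.val_mul, ← zpow_natCast, ← zpow_add]
    congr 3
    rw [habove, hcompl, hinter]
    split_ifs <;> ring
  rw [sum_congr rfl hterm, ← mul_sum, hH Q hQs hQ, mul_zero]

theorem exists_rotation_of_lt_of_lt (hpos : Set.InjOn pos s) (hP : P ⊆ s)
    (halt : ¬ HasAlternation pos s P) {p n p' : α} (hp : p ∈ P) (hn : n ∈ s ∧ n ∉ P) (hp' : p' ∈ P)
    (hpn : pos p < pos n) (hnp' : pos n < pos p') :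
    ∃ X : Finset α, (∀ x ∈ X, ∀ y ∈ s \ X, pos x < pos y) ∧
      ∀ p ∈ P, ∀ n ∈ s \ P, rotatedPos X pos p < rotatedPos X pos n := by
  simp only [rotatedPos_lt_rotatedPos, mem_sdiff]
  have hne : ∀ p ∈ P, ∀ n ∈ s, n ∉ P → pos p ≠ pos n := fun p hp n hn hnP h =>
    hnP (hpos (hP hp) hn h ▸ hp)
  refine ⟨{i ∈ s | ∃ n ∈ s, n ∉ P ∧ pos i ≤ pos n}, ?_, ?_⟩ <;> simp only [mem_filter]
  · rintro x ⟨-, n, hn, hnP, hxn⟩ y ⟨hy, hlt⟩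
    exact hxn.trans_lt (lt_of_not_ge fun hle => hlt ⟨hy, n, hn, hnP, hle⟩)
  · rintro p₁ hp₁ n₁ ⟨hn₁, hn₁P⟩
    by_cases hp₁X : ∃ n₂ ∈ s, n₂ ∉ P ∧ pos p₁ ≤ pos n₂
    · refine Or.inr ⟨iff_of_true ⟨hP hp₁, hp₁X⟩ ⟨hn₁, n₁, hn₁, hn₁P, le_rfl⟩, ?_⟩
      obtain ⟨n₂, hn₂, hn₂P, hpn₂⟩ := hp₁X
      refine (hne p₁ hp₁ n₁ hn₁ hn₁P).lt_or_gt.resolve_right fun h => halt ?_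
      exact hasAlternation_of_lt_of_lt hpos ⟨hP hp, hp⟩ hn ⟨hP hp', hp'⟩ hpn hnp'
        ⟨hn₁, hn₁P⟩ ⟨hP hp₁, hp₁⟩ ⟨hn₂, hn₂P⟩ h (hpn₂.lt_of_ne (hne p₁ hp₁ n₂ hn₂ hn₂P))
    · exact Or.inl ⟨fun h => hp₁X h.2, hn₁, n₁, hn₁, hn₁P, le_rfl⟩

theorem exists_rotation_of_convex (hpos : Set.InjOn pos s) (hP : P ⊆ s)
    (hconvex : ∀ p ∈ P, ∀ n ∈ s \ P, ∀ p' ∈ P, pos p < pos n → pos p' ≤ pos n) :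
    ∃ X : Finset α, (∀ x ∈ X, ∀ y ∈ s \ X, pos x < pos y) ∧
      ∀ p ∈ P, ∀ n ∈ s \ P, rotatedPos X pos p < rotatedPos X pos n := by
  simp only [rotatedPos_lt_rotatedPos, mem_sdiff]
  have hne : ∀ p ∈ P, ∀ n ∈ s, n ∉ P → pos p ≠ pos n := fun p hp n hn hnP h =>
    hnP (hpos (hP hp) hn h ▸ hp)
  refine ⟨{i ∈ s | ∀ p ∈ P, pos i < pos p}, ?_, ?_⟩ <;> simp only [mem_filter]
  · rintro x ⟨-, hx⟩ y ⟨hy, hle⟩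
    obtain ⟨p, hp, hpy⟩ : ∃ p ∈ P, pos p ≤ pos y := by
      by_contra! hcon
      exact hle ⟨hy, hcon⟩
    exact (hx p hp).trans_le hpy
  · rintro p hp n ⟨hn, hnP⟩
    have hpX : ¬ (p ∈ s ∧ ∀ p' ∈ P, pos p < pos p') := fun h => (h.2 p hp).false
    by_cases hnX : ∀ p' ∈ P, pos n < pos p'
    · exact Or.inl ⟨hpX, hn, hnX⟩
    · refine Or.inr ⟨iff_of_false hpX fun h => hnX h.2, ?_⟩
      push Not at hnX
      obtain ⟨p', hp', hle⟩ := hnX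
      exact ((hconvex p' hp' n (mem_sdiff.2 ⟨hn, hnP⟩) p hp
        (hle.lt_of_ne (hne p' hp' n hn hnP))).lt_of_ne (hne p hp n hn hnP))

theorem exists_rotation_of_not_hasAlternation (hpos : Set.InjOn pos s) (hP : P ⊆ s)
    (halt : ¬ HasAlternation pos s P) :
    ∃ X : Finset α, (∀ x ∈ X, ∀ y ∈ s \ X, pos x < pos y) ∧
      ∀ p ∈ P, ∀ n ∈ s \ P, rotatedPos X pos p < rotatedPos X pos n := by
  by_cases hconvex : ∃ p ∈ P, ∃ n ∈ s \ P, ∃ p' ∈ P, pos p < pos n ∧ pos n < pos p'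
  · obtain ⟨p, hp, n, hn, p', hp', hpn, hnp'⟩ := hconvex
    exact exists_rotation_of_lt_of_lt hpos hP halt hp (mem_sdiff.1 hn) hp' hpn hnp'
  · push Not at hconvex
    exact exists_rotation_of_convex hpos hP hconvex

theorem sum_card_filter_lt_of_forall_lt {X Y : Finset α} (hX : #X = a) (hY : #Y = a)
    (hXY : ∀ x ∈ X, ∀ y ∈ Y, pos x < pos y) (hpos : Set.InjOn pos ↑(X ∪ Y)) :
    ∑ x ∈ X, #{j ∈ X ∪ Y | pos x < pos j} = a * a + ∑ y ∈ Y, #{j ∈ X ∪ Y | pos y < pos j} := by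
  have hdisj : Disjoint X Y := disjoint_left.2 fun x hx hy => (hXY x hx x hy).false
  have hleft : ∀ x ∈ X, #{j ∈ X ∪ Y | pos x < pos j} = #{j ∈ X | pos x < pos j} + a :=
    fun x hx => by
      rw [filter_union, card_union_of_disjoint (disjoint_filter_filter hdisj),
        filter_true_of_mem (s := Y) (hXY x hx), hY]
  have hright : ∀ y ∈ Y, #{j ∈ X ∪ Y | pos y < pos j} = #{j ∈ Y | pos y < pos j} :=
    fun y hy => by
      rw [filter_union, filter_false_of_mem (s := X) fun x hx => (hXY x hx y hy).not_gt,
        empty_union]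
  rw [sum_congr rfl hleft, sum_congr rfl hright, sum_add_distrib, sum_const, hX, smul_eq_mul,
    sum_apply_card_filter_lt (fun m => m) (hpos.mono (by simp)),
    sum_apply_card_filter_lt (fun m => m) (hpos.mono (by simp)), hX, hY, add_comm]

theorem sum_bijOn_eq_of_rotation {π : α → α} (hP : P ⊆ s) (hPa : #P = a) (hNa : #(s \ P) = a)
    (hpos : Set.InjOn pos s) (hX : ∀ x ∈ X, ∀ y ∈ s \ X, pos x < pos y)
    (hlt : ∀ p ∈ P, ∀ n ∈ s \ P, rotatedPos X pos p < rotatedPos X pos n)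
    (hπ : Set.BijOn π P ↑(s \ P)) :
    ∑ p ∈ P, arcShift pos s p (π p) =
      (a - 1) * (a - 2 * (#((s \ P) ∩ X) - #(P ∩ X))) := by
  have hunion : P ∪ s \ P = s := union_sdiff_of_subset hP
  have hs : (#s : ℤ) = 2 * a := by rw [← card_sdiff_add_card_eq_card hP]; push_cast [hPa, hNa]; ring
  have hπN : ∀ p ∈ P, π p ∈ s \ P := hπ.mapsTo
  have hsumπ : ∀ f : α → ℤ, ∑ p ∈ P, f (π p) = ∑ n ∈ s \ P, f n := fun f =>
    sum_nbij π hπ.mapsTo hπ.injOn hπ.surjOn fun _ _ => rfl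
  have hindicator : ∀ A : Finset α, ∑ i ∈ A, (if i ∈ X then 1 else 0 : ℤ) = #(A ∩ X) := fun A => by
    simp
  have hsign : ∀ p ∈ P, (if pos p < pos (π p) then -1 else 1 : ℤ) =
      2 * ((if π p ∈ X then 1 else 0) - if p ∈ X then 1 else 0) - 1 := by
    intro p hp
    have hpn := hlt p hp _ (hπN p hp)
    simp only [rotatedPos_lt_rotatedPos] at hpn
    have hnot : π p ∈ X → p ∉ X → ¬ pos p < pos (π p) := fun h h' =>
      (hX _ h p (mem_sdiff.2 ⟨hP hp, h'⟩)).not_gt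
    by_cases hpX : p ∈ X <;> by_cases hnX : π p ∈ X <;> simp_all
  have habove := sum_card_filter_lt_of_forall_lt hPa hNa hlt (hunion.symm ▸ injOn_rotatedPos hpos)
  rw [hunion] at habove
  zify at habove
  have hshift : ∀ A ⊆ s, ∑ i ∈ A, (#{j ∈ s | rotatedPos X pos i < rotatedPos X pos j} : ℤ) =
     ∑ i ∈ A, (#{j ∈ s | pos i < pos j} : ℤ) + #A * #(s ∩ X) - 2 * a * #(A ∩ X) := by
    intro A hA
    rw [sum_congr rfl fun i hi => card_filter_rotatedPos_lt hX Subset.rfl (hA hi),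
      sum_sub_distrib, sum_add_distrib, sum_const, nsmul_eq_mul, ← hindicator, mul_sum, hs]
    simp [mul_comm]
  rw [hshift P hP, hshift _ sdiff_subset, hPa, hNa] at habove
  simp only [arcShift]
  rw [sum_add_distrib, sum_sub_distrib, hsumπ fun n => (#{j ∈ s | pos n < pos j} : ℤ),
    sum_congr rfl hsign, sum_sub_distrib, ← mul_sum, sum_sub_distrib, hindicator,
    hsumπ fun n => if n ∈ X then 1 else 0, hindicator, sum_const, hPa, nsmul_eq_mul]
  linear_combination habove

theorem LoweringRelation.apply_eq_zpow_mul [CommRing R] [IsDomain R] {q : Rˣ}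
    {H : Finset α → R} (hH : LoweringRelation (q : R) pos s a H)
    (hq : ∀ k, ∑ m ∈ range (k + 1), (q : R) ^ m ≠ 0) (hP : P ⊆ s) (hPa : #P = a)
    (hNa : #(s \ P) = a) (hpos : Set.InjOn pos s) (halt : ¬ HasAlternation pos s P) {π : α → α}
    (hπ : Set.BijOn π P ↑(s \ P)) {e : ℤ}
    (he : ∑ p ∈ P, arcShift pos s p (π p) = 2 * e) :
    H P = (-1) ^ a * ↑(q ^ e) * H (s \ P) := by
  obtain ⟨X, hX, hlt⟩ := exists_rotation_of_not_hasAlternation hpos hP halt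
  have hunion : P ∪ s \ P = s := union_sdiff_of_subset hP
  have hs : #s = 2 * a := by rw [← card_sdiff_add_card_eq_card hP]; lia
  have hrot := hH.rotate hs hX
  rw [← hunion] at hrot
  have hval := hrot.apply_eq_of_forall_lt hq hPa hNa hlt (hunion.symm ▸ injOn_rotatedPos hpos)
  rw [sum_bijOn_eq_of_rotation hP hPa hNa hpos hX hlt hπ] at he
  have hchoose : (a.choose 2 * 2 : ℤ) = a * (a - 1) := by
    exact_mod_cast (Nat.cast_choose_two ℚ a ▸ div_mul_cancel₀ _ two_ne_zero :
      (a.choose 2 * 2 : ℚ) = a * (a - 1))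
  have hexp : e = (a - 1) * #(P ∩ X) + (a.choose 2 + -((a - 1) * #((s \ P) ∩ X))) := by
    refine mul_left_cancel₀ two_ne_zero ?_
    linear_combination -he - hchoose
  calc H P = ↑(q ^ ((a - 1) * #(P ∩ X) : ℤ)) * (↑(q ^ (-((a - 1) * #(P ∩ X)) : ℤ)) * H P) := by
        rw [← mul_assoc, ← Units.val_mul, ← zpow_add, add_neg_cancel, zpow_zero, Units.val_one,
          one_mul]
    _ = (-1) ^ a * ↑(q ^ e) * H (s \ P) := by
        rw [hval, hexp, zpow_add, zpow_add, zpow_natCast]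
        push_cast
        ring

end Rotation

section Matchings

open Finset

variable {α ι : Type*} [LinearOrder ι] {pos : α → ι} {s P : Finset α} {M : Finset (Sym2 α)}
  {x y b c : α}

/-- A perfect matching of `s` by pairs with one element in `P` and one element outside `P`, which
is non-crossing for the linear order given by `pos`. -/
structure IsNCMatching (pos : α → ι) (s P : Finset α) (M : Finset (Sym2 α)) : Prop where
  mem : ∀ a ∈ M, ∀ b ∈ a, b ∈ s
  opposite : ∀ b c, s(b, c) ∈ M → (b ∈ P ↔ c ∉ P)
  covers : ∀ b ∈ s, ∃! a, a ∈ M ∧ b ∈ a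
  noncrossing : ∀ b₁ b₂ c₁ c₂, s(b₁, c₁) ∈ M → s(b₂, c₂) ∈ M →
    ¬ (pos b₁ < pos b₂ ∧ pos b₂ < pos c₁ ∧ pos c₁ < pos c₂)

/-- Two consecutive elements `x`, `y` of `s`, exactly one of which lies in `P`. -/
structure IsColorChange (pos : α → ι) (s P : Finset α) (x y : α) : Prop where
  left_mem : x ∈ s
  right_mem : y ∈ s
  lt : pos x < pos y
  le_of_lt : ∀ j ∈ s, pos x < pos j → pos y ≤ pos j
  opposite : x ∈ P ↔ y ∉ P

theorem exists_isColorChange (hpos : Set.InjOn pos s) {p r : α} (hp : p ∈ s)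
    (hr : r ∈ s) (hpr : pos p < pos r) (hP : p ∈ P ↔ r ∉ P) :
    ∃ x y, IsColorChange pos s P x y ∧ pos p ≤ pos x ∧ pos y ≤ pos r ∧ (x ∈ P ↔ p ∈ P) := by
  classical
  obtain ⟨x, hx, hxmax⟩ := exists_max_image {j ∈ s | pos p ≤ pos j ∧ pos j < pos r ∧
    (j ∈ P ↔ p ∈ P)} pos ⟨p, by simp [hp, hpr]⟩
  obtain ⟨hxs, hpx, hxr, hxp⟩ := mem_filter.1 hx
  obtain ⟨y, hy, hymin⟩ := exists_min_image {j ∈ s | pos x < pos j} pos ⟨r, by simp [hr, hxr]⟩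
  obtain ⟨hys, hxy⟩ := mem_filter.1 hy
  have hyr : pos y ≤ pos r := hymin r (mem_filter.2 ⟨hr, hxr⟩)
  refine ⟨x, y, ⟨hxs, hys, hxy, fun j hj h => hymin j (mem_filter.2 ⟨hj, h⟩), hxp.trans ?_⟩,
    hpx, hyr, hxp⟩
  rcases hyr.eq_or_lt with h | h
  · rwa [hpos hys hr h]
  · have hnot : ¬ (y ∈ P ↔ p ∈ P) := fun hyp =>
      (hxmax y (mem_filter.2 ⟨hys, hpx.trans hxy.le, h, hyp⟩)).not_gt hxy
    tauto

namespace IsNCMatching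

theorem left_mem (hM : IsNCMatching pos s P M) (h : s(b, c) ∈ M) : b ∈ s :=
  hM.mem _ h b (Sym2.mem_mk_left _ _)

theorem right_mem (hM : IsNCMatching pos s P M) (h : s(b, c) ∈ M) : c ∈ s :=
  hM.mem _ h c (Sym2.mem_mk_right _ _)

theorem exists_partner (hM : IsNCMatching pos s P M) :
    ∃ π : α → α, ∀ b ∈ s, ∀ c, s(b, c) ∈ M ↔ π b = c := by
  have hex : ∀ b, ∃ c, b ∈ s → s(b, c) ∈ M := fun b => by
    by_cases hb : b ∈ s
    · obtain ⟨a, ⟨ha, hba⟩, -⟩ := hM.covers b hb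
      obtain ⟨c, rfl⟩ := Sym2.mem_iff_exists.1 hba
      exact ⟨c, fun _ => ha⟩
    · exact ⟨b, fun h => absurd h hb⟩
  choose π hπ using hex
  refine ⟨π, fun b hb c => ⟨fun h => ?_, fun h => h ▸ hπ b hb⟩⟩
  exact Sym2.congr_right.1 ((hM.covers b hb).unique ⟨hπ b hb, Sym2.mem_mk_left _ _⟩
    ⟨h, Sym2.mem_mk_left _ _⟩)

theorem partner_partner (hM : IsNCMatching pos s P M) {π : α → α}
    (hπ : ∀ b ∈ s, ∀ c, s(b, c) ∈ M ↔ π b = c) (hb : b ∈ s) : π (π b) = b := by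
  have hbM := (hπ b hb _).2 rfl
  exact (hπ _ (hM.right_mem hbM) b).1 (Sym2.eq_swap ▸ hbM)

theorem even_card_between (hM : IsNCMatching pos s P M) (hpos : Set.InjOn pos s)
    (hxy : s(x, y) ∈ M) : Even #{j ∈ s | pos x < pos j ∧ pos j < pos y} := by
  obtain ⟨π, hπ⟩ := hM.exists_partner
  have harc : ∀ j ∈ s, s(j, π j) ∈ M := fun j hj => (hπ j hj _).2 rfl
  have hx := hM.left_mem hxy
  have hy := hM.right_mem hxy
  have hππ : ∀ j ∈ s, π (π j) = j := fun j => hM.partner_partner hπ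
  have hπx : π x = y := (hπ x hx y).1 hxy
  have hsum : ∑ j ∈ s with pos x < pos j ∧ pos j < pos y, (1 : ZMod 2) = 0 := by
    refine sum_involution (fun j _ => π j) (fun _ _ => by decide) ?_ ?_
      fun j hj => hππ j (mem_filter.1 hj).1
    · intro j hj _ h
      have := hM.opposite _ _ (harc j (mem_filter.1 hj).1)
      rw [h] at this
      tauto
    · intro j hj
      obtain ⟨hjs, hxj, hjy⟩ := mem_filter.1 hj
      have hπjs := hM.right_mem (harc j hjs)
      have hπjx : pos x ≠ pos (π j) := fun h =>
        hjy.ne (by rw [← hπx, hpos hx hπjs h, hππ j hjs])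
      have hπjy : pos (π j) ≠ pos y := fun h =>
        hxj.ne (by rw [← hππ j hjs, hpos hπjs hy h, ← hπx, hππ x hx])
      refine mem_filter.2 ⟨hπjs, hπjx.lt_of_le (le_of_not_gt fun h => ?_),
        hπjy.lt_of_le (le_of_not_gt fun h => ?_)⟩
      · exact hM.noncrossing _ _ _ _ (Sym2.eq_swap ▸ harc j hjs) hxy ⟨h, hxj, hjy⟩
      · exact hM.noncrossing _ _ _ _ hxy (harc j hjs) ⟨hxj, hjy, h⟩
  rw [← ZMod.natCast_eq_zero_iff_even]
  simpa using hsum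

variable [DecidableEq α]

theorem covers_insert (hM : IsNCMatching pos ((s.erase x).erase y) P M) (hb : b ∈ s) :
    ∃! a, a ∈ insert s(x, y) M ∧ b ∈ a := by
  have hmem : ∀ a ∈ M, ∀ b ∈ a, b ≠ y ∧ b ≠ x := fun a ha b hb => by
    have := hM.mem a ha b hb
    simp only [mem_erase] at this
    exact ⟨this.1, this.2.1⟩
  by_cases hbxy : b = x ∨ b = y
  · refine ⟨s(x, y), ⟨mem_insert_self _ _, Sym2.mem_iff.2 hbxy⟩, ?_⟩
    rintro a ⟨ha, hba⟩
    have := fun h => hmem a h b hba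
    exact (mem_insert.1 ha).resolve_right (by tauto)
  · obtain ⟨a, ⟨ha, hba⟩, hunique⟩ := hM.covers b (by simp only [mem_erase]; tauto)
    refine ⟨a, ⟨mem_insert_of_mem ha, hba⟩, ?_⟩
    rintro a' ⟨ha', hba'⟩
    refine hunique a' ⟨(mem_insert.1 ha').resolve_left fun h => ?_, hba'⟩
    exact hbxy (Sym2.mem_iff.1 (h ▸ hba'))

theorem insert (hM : IsNCMatching pos ((s.erase x).erase y) P M) (h : IsColorChange pos s P x y) :
    IsNCMatching pos s P (insert s(x, y) M) := by
  have hsub : (s.erase x).erase y ⊆ s := (erase_subset _ _).trans (erase_subset _ _)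
  refine ⟨fun a ha b hb => ?_, fun b c hbc => ?_, fun b => hM.covers_insert, ?_⟩
  · rcases mem_insert.1 ha with rfl | ha
    · rcases Sym2.mem_iff.1 hb with rfl | rfl
      exacts [h.left_mem, h.right_mem]
    · exact hsub (hM.mem a ha b hb)
  · rcases mem_insert.1 hbc with hbc | hbc
    · have := h.opposite
      rcases Sym2.eq_iff.1 hbc with ⟨rfl, rfl⟩ | ⟨rfl, rfl⟩ <;> tauto
    · exact hM.opposite b c hbc
  · rintro b₁ b₂ c₁ c₂ h₁ h₂ ⟨hb, hbc, hc⟩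
    have hxy := h.lt
    rcases mem_insert.1 h₁ with e₁ | m₁ <;> rcases mem_insert.1 h₂ with e₂ | m₂
    · rcases Sym2.eq_iff.1 e₁ with ⟨rfl, rfl⟩ | ⟨rfl, rfl⟩ <;>
        rcases Sym2.eq_iff.1 e₂ with ⟨rfl, rfl⟩ | ⟨rfl, rfl⟩ <;> order
    · rcases Sym2.eq_iff.1 e₁ with ⟨rfl, rfl⟩ | ⟨rfl, rfl⟩
      · exact (h.le_of_lt b₂ (hsub (hM.left_mem m₂)) hb).not_gt hbc
      · order
    · rcases Sym2.eq_iff.1 e₂ with ⟨rfl, rfl⟩ | ⟨rfl, rfl⟩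
      · exact (h.le_of_lt c₁ (hsub (hM.right_mem m₁)) hbc).not_gt hc
      · order
    · exact hM.noncrossing _ _ _ _ m₁ m₂ ⟨hb, hbc, hc⟩

end IsNCMatching

variable [DecidableEq α]

theorem card_filter_erase_erase_add_one {p : α → Prop} [DecidablePred p] (hx : x ∈ s) (hy : y ∈ s)
    (hp : p x ↔ ¬ p y) : #{j ∈ (s.erase x).erase y | p j} + 1 = #{j ∈ s | p j} := by
  rw [filter_erase, filter_erase]
  by_cases hpy : p y
  · rw [erase_eq_of_notMem (a := x) (by simp; tauto), card_erase_add_one (by simp [hy, hpy])]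
  · rw [erase_eq_of_notMem (a := y) (by simp [hpy]), card_erase_add_one (by simp [hx, hp.2 hpy])]

namespace IsColorChange

variable (h : IsColorChange pos s P x y)
include h

theorem erase_erase_ssubset : (s.erase x).erase y ⊂ s :=
  (erase_subset _ _).trans_ssubset (erase_ssubset h.left_mem)

theorem mem_erase_erase {z : α} (hz : z ∈ s) (hlt : pos z < pos x ∨ pos y < pos z) :
    z ∈ (s.erase x).erase y := by
  have hxy := h.lt
  simp only [mem_erase]
  refine ⟨?_, ?_, hz⟩ <;> rintro rfl <;> rcases hlt with hlt | hlt <;> order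

theorem balanced_erase_erase (hbal : #{j ∈ s | j ∈ P} = #{j ∈ s | j ∉ P}) :
    #{j ∈ (s.erase x).erase y | j ∈ P} = #{j ∈ (s.erase x).erase y | j ∉ P} := by
  have hin := card_filter_erase_erase_add_one (p := (· ∈ P)) h.left_mem h.right_mem h.opposite
  have hout := card_filter_erase_erase_add_one (p := (· ∉ P)) h.left_mem h.right_mem
    (not_congr h.opposite)
  lia

end IsColorChange

omit [LinearOrder ι] in
theorem injOn_erase_erase (hpos : Set.InjOn pos s) : Set.InjOn pos ↑((s.erase x).erase y) :=
  hpos.mono (coe_subset.2 ((erase_subset _ _).trans (erase_subset _ _)))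

theorem exists_isColorChange_of_balanced (hpos : Set.InjOn pos s)
    (hbal : #{j ∈ s | j ∈ P} = #{j ∈ s | j ∉ P}) (hs : s.Nonempty) :
    ∃ x y, IsColorChange pos s P x y := by
  have hcard := card_filter_add_card_filter_not (s := s) (· ∈ P)
  have hs_pos := card_pos.2 hs
  obtain ⟨p, hp⟩ := card_pos.1 (show 0 < #{j ∈ s | j ∈ P} by lia)
  obtain ⟨r, hr⟩ := card_pos.1 (show 0 < #{j ∈ s | j ∉ P} by lia)
  rw [mem_filter] at hp hr
  have hne : pos p ≠ pos r := fun h => hr.2 (hpos hp.1 hr.1 h ▸ hp.2)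
  rcases hne.lt_or_gt with h | h
  · obtain ⟨x, y, hxy, -⟩ := exists_isColorChange (P := P) hpos hp.1 hr.1 h (by tauto)
    exact ⟨x, y, hxy⟩
  · obtain ⟨x, y, hxy, -⟩ := exists_isColorChange (P := P) hpos hr.1 hp.1 h (by tauto)
    exact ⟨x, y, hxy⟩

theorem exists_isNCMatching (hpos : Set.InjOn pos s)
    (hbal : #{j ∈ s | j ∈ P} = #{j ∈ s | j ∉ P}) : ∃ M, IsNCMatching pos s P M := by
  induction s using Finset.strongInduction with
  | H s ih =>
    rcases s.eq_empty_or_nonempty with rfl | hs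
    · exact ⟨∅, by simp, by simp, by simp, by simp⟩
    · obtain ⟨x, y, hxy⟩ := exists_isColorChange_of_balanced hpos hbal hs
      obtain ⟨M, hM⟩ := ih _ hxy.erase_erase_ssubset (injOn_erase_erase hpos)
        (hxy.balanced_erase_erase hbal)
      exact ⟨_, hM.insert hxy⟩

theorem IsColorChange.mem_of_unique (h : IsColorChange pos s P x y)
    (hunique : ∀ M', IsNCMatching pos s P M' → M' = M) (hpos : Set.InjOn pos s)
    (hbal : #{j ∈ s | j ∈ P} = #{j ∈ s | j ∉ P}) : s(x, y) ∈ M := by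
  obtain ⟨M', hM'⟩ := exists_isNCMatching (injOn_erase_erase hpos) (h.balanced_erase_erase hbal)
  rw [← hunique _ (hM'.insert h)]
  exact mem_insert_self _ _

theorem IsColorChange.unique_erase_erase (h : IsColorChange pos s P x y)
    (hunique : ∀ M', IsNCMatching pos s P M' → M' = M) {N : Finset (Sym2 α)}
    (hN : IsNCMatching pos ((s.erase x).erase y) P N) : N = M.erase s(x, y) := by
  rw [← hunique _ (hN.insert h), erase_insert]
  exact fun hxy => by simpa using hN.left_mem hxy

theorem not_hasAlternation_of_unique (hM : IsNCMatching pos s P M)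
    (hunique : ∀ M', IsNCMatching pos s P M' → M' = M) (hpos : Set.InjOn pos s)
    (hbal : #{j ∈ s | j ∈ P} = #{j ∈ s | j ∉ P}) : ¬ HasAlternation pos s P := by
  -- Color changes are arcs of the unique matching, so consecutive ones share no element, and an
  -- alternation survives the removal of the middle one of its three color changes.
  induction s using Finset.strongInduction generalizing M with
  | H s ih =>
    rintro ⟨i, hi, j, hj, k, hk, l, hl, hij, hjk, hkl, cij, cjk, ckl⟩
    obtain ⟨x₁, y₁, h₁, -, hy₁, cx₁⟩ := exists_isColorChange hpos hi hj hij cij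
    obtain ⟨x₂, y₂, h₂, hx₂, hy₂, cx₂⟩ := exists_isColorChange hpos hj hk hjk cjk
    obtain ⟨x₃, y₃, h₃, hx₃, -, cx₃⟩ := exists_isColorChange hpos hk hl hkl ckl
    have hlt : ∀ {x y x' y'}, IsColorChange pos s P x y → IsColorChange pos s P x' y' →
        pos y ≤ pos x' → pos y < pos x' := fun {x y x' y'} h h' hle => by
      refine hle.lt_of_ne fun heq => ?_
      obtain rfl := hpos h.right_mem h'.left_mem heq
      have harc := (hM.covers y h.right_mem).unique
        ⟨h.mem_of_unique hunique hpos hbal, Sym2.mem_mk_right _ _⟩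
        ⟨h'.mem_of_unique hunique hpos hbal, Sym2.mem_mk_left _ _⟩
      have hxy := h.lt
      have hyx' := h'.lt
      rcases Sym2.eq_iff.1 harc with ⟨rfl, rfl⟩ | ⟨rfl, -⟩ <;> order
    have h₁₂ := hlt h₁ h₂ (hy₁.trans hx₂)
    have h₂₃ := hlt h₂ h₃ (hy₂.trans hx₃)
    obtain ⟨N, hN⟩ := exists_isNCMatching (injOn_erase_erase hpos) (h₂.balanced_erase_erase hbal)
    obtain rfl := h₂.unique_erase_erase hunique hN
    refine ih _ h₂.erase_erase_ssubset hN (fun _ => h₂.unique_erase_erase hunique)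
      (injOn_erase_erase hpos) (h₂.balanced_erase_erase hbal) ?_
    exact ⟨x₁, h₂.mem_erase_erase h₁.left_mem (.inl (h₁.lt.trans h₁₂)),
      y₁, h₂.mem_erase_erase h₁.right_mem (.inl h₁₂),
      x₃, h₂.mem_erase_erase h₃.left_mem (.inr h₂₃),
      y₃, h₂.mem_erase_erase h₃.right_mem (.inr (h₂₃.trans h₃.lt)),
      h₁.lt, h₁₂.trans (h₂.lt.trans h₂₃), h₃.lt, h₁.opposite,
      by have := h₁.opposite; tauto, h₃.opposite⟩

end Matchings

section Lattice

variable {R : Type*} [CommRing R]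

/-- The weight of a vertex of the two-colored lattice model.  The pairs of Booleans are the blue
and the red occupation numbers of the left edge `h`, the bottom edge `a`, the top edge `b` and the
right edge `g`. -/
def vertexWeight (t x : R) (h a b g : Bool × Bool) : R :=
  if h.1.toNat + a.1.toNat = b.1.toNat + g.1.toNat ∧ h.1.toNat + a.1.toNat ≤ 1 ∧
      h.2.toNat + a.2.toNat = b.2.toNat + g.2.toNat ∧ h.2.toNat + a.2.toNat ≤ 1 then
    x ^ (g.1.toNat + g.2.toNat) * t ^ (g.1.toNat * (h.2.toNat + a.2.toNat))
  else 0

/-- The weight of a row of the lattice model with bottom boundary `σ`, top boundary `τ`, left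
boundary `h` and empty right boundary. -/
def rowWeight (t x : R) : {m : ℕ} → (Fin m → Bool × Bool) → (Fin m → Bool × Bool) → Bool × Bool → R
  | 0, _, _, h => if h = (false, false) then 1 else 0
  | _ + 1, σ, τ, h =>
    ∑ g : Bool × Bool, vertexWeight t x h (σ 0) (τ 0) g * rowWeight t x (Fin.tail σ) (Fin.tail τ) g

/-- The factor of the flip operator for a column with occupation numbers `a` to the right of the
flipped one: the action of the Cartan generator of `U_q(sl₂)` in the coproduct of a lowering
operator. -/
def flipFactor (t : R) (a : Bool × Bool) : R :=
  (if a.1 then -1 else 1) * (if a.2 then -t else 1)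

/-- The coefficient of the flip operator at the column `i`. -/
def flipCoeff (t : R) {m : ℕ} (σ : Fin m → Bool × Bool) (i : Fin m) : R :=
  ∏ j ∈ Finset.Ioi i, flipFactor t (σ j)

/-- The flip operator applied to `f`: the sum of the values of `f` at the states obtained from `σ`
by changing one column from `a` to `b`, with the coefficients `flipCoeff`. -/
def flipSum (t : R) (a b : Bool × Bool) {m : ℕ} (σ : Fin m → Bool × Bool)
    (f : (Fin m → Bool × Bool) → R) : R :=
  ∑ i, if σ i = a then flipCoeff t σ i * f (Function.update σ i b) else 0

theorem vertexWeight_conservation (t x : R) (h a b g : Bool × Bool) :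
    flipFactor t b * flipFactor t g * vertexWeight t x h a b g =
      flipFactor t h * flipFactor t a * vertexWeight t x h a b g := by
  rcases h with ⟨_ | _, _ | _⟩ <;> rcases a with ⟨_ | _, _ | _⟩ <;>
    rcases b with ⟨_ | _, _ | _⟩ <;> rcases g with ⟨_ | _, _ | _⟩ <;>
    simp [vertexWeight, flipFactor]

theorem vertexWeight_flip (t x : R) (h a b g : Bool × Bool) :
    (if a = (true, false) then vertexWeight t x h (false, true) b g else 0) +
        (if h = (true, false) then flipFactor t a * vertexWeight t x (false, true) a b g else 0) =
      (if b = (false, true) then flipFactor t g * vertexWeight t x h a (true, false) g else 0) +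
        (if g = (false, true) then vertexWeight t x h a b (true, false) else 0) := by
  rcases h with ⟨_ | _, _ | _⟩ <;> rcases a with ⟨_ | _, _ | _⟩ <;>
    rcases b with ⟨_ | _, _ | _⟩ <;> rcases g with ⟨_ | _, _ | _⟩ <;>
    simp [vertexWeight, flipFactor] <;> ring

theorem rowWeight_conservation (t x : R) {m : ℕ} (σ τ : Fin m → Bool × Bool) (h : Bool × Bool) :
    (∏ j, flipFactor t (τ j)) * rowWeight t x σ τ h =
      flipFactor t h * (∏ j, flipFactor t (σ j)) * rowWeight t x σ τ h := by
  induction m generalizing h with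
  | zero =>
    rw [rowWeight]
    split_ifs with hh <;> simp [hh, flipFactor]
  | succ m ih =>
    rw [rowWeight, Fin.prod_univ_succ, Fin.prod_univ_succ, Finset.mul_sum, Finset.mul_sum]
    refine Finset.sum_congr rfl fun g _ => ?_
    have htail := ih (Fin.tail σ) (Fin.tail τ) g
    simp only [Fin.tail] at htail ⊢
    linear_combination flipFactor t (τ 0) * vertexWeight t x h (σ 0) (τ 0) g * htail +
      (∏ j : Fin m, flipFactor t (σ j.succ)) * rowWeight t x (Fin.tail σ) (Fin.tail τ) g *
        vertexWeight_conservation t x h (σ 0) (τ 0) g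

theorem flipSum_succ (t : R) (a b : Bool × Bool) {m : ℕ} (σ : Fin (m + 1) → Bool × Bool)
    (f : (Fin (m + 1) → Bool × Bool) → R) :
    flipSum t a b σ f =
      (if σ 0 = a then (∏ j, flipFactor t (Fin.tail σ j)) * f (Fin.cons b (Fin.tail σ)) else 0) +
        flipSum t a b (Fin.tail σ) fun ρ => f (Fin.cons (σ 0) ρ) := by
  have hcons (i : Fin m) : (Fin.cons (σ 0) (Function.update (Fin.tail σ) i b) :
      Fin (m + 1) → Bool × Bool) = Function.update σ i.succ b := by
    rw [Fin.cons_update, Fin.cons_self_tail]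
  have hzero : (Fin.cons b (Fin.tail σ) : Fin (m + 1) → Bool × Bool) = Function.update σ 0 b := by
    rw [← Fin.update_cons_zero (σ 0), Fin.cons_self_tail]
  simp only [flipSum, flipCoeff, Fin.sum_univ_succ, Fin.prod_Ioi_zero, Fin.prod_Ioi_succ, hcons,
    hzero]
  rfl

theorem flipSum_sum_mul (t : R) (a b : Bool × Bool) {m : ℕ} (σ : Fin m → Bool × Bool)
    {κ : Type*} [Fintype κ] (c : κ → R) (f : κ → (Fin m → Bool × Bool) → R) :
    flipSum t a b σ (fun ρ => ∑ g, c g * f g ρ) = ∑ g, c g * flipSum t a b σ (f g) := by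
  simp only [flipSum, Finset.mul_sum]
  rw [Finset.sum_comm]
  refine Finset.sum_congr rfl fun i _ => ?_
  split_ifs
  · exact Finset.sum_congr rfl fun g _ => by ring
  · simp

theorem flipSum_rowWeight (t x : R) {m : ℕ} (σ τ : Fin m → Bool × Bool) (h : Bool × Bool) :
    flipSum t (true, false) (false, true) σ (fun ρ => rowWeight t x ρ τ h) +
        (if h = (true, false) then
          (∏ j, flipFactor t (σ j)) * rowWeight t x σ τ (false, true) else 0) =
      flipSum t (false, true) (true, false) τ (fun ρ => rowWeight t x σ ρ h) := by
  induction m generalizing h with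
  | zero => simp [flipSum, rowWeight]
  | succ m ih =>
    set K := ∏ j, flipFactor t (Fin.tail σ j)
    set W := rowWeight t x (Fin.tail σ) (Fin.tail τ)
    have hprod : ∏ j, flipFactor t (σ j) = flipFactor t (σ 0) * K := Fin.prod_univ_succ _
    have hconserve (g) : (∏ j, flipFactor t (Fin.tail τ j)) * W g = flipFactor t g * K * W g :=
      rowWeight_conservation t x (Fin.tail σ) (Fin.tail τ) g
    have hvertex := Finset.sum_congr rfl fun g (_ : g ∈ Finset.univ) =>
      congrArg (· * (K * W g)) (vertexWeight_flip t x h (σ 0) (τ 0) g)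
    simp only [add_mul, Finset.sum_add_distrib, ite_mul, zero_mul, Finset.sum_ite_irrel,
      Finset.sum_const_zero, Finset.sum_ite_eq', Finset.mem_univ, if_true] at hvertex
    have hτ (v : Bool × Bool → R) : (∏ j, flipFactor t (Fin.tail τ j)) * ∑ g, v g * W g =
        ∑ g, flipFactor t g * v g * (K * W g) := by
      rw [Finset.mul_sum]
      exact Finset.sum_congr rfl fun g _ => by linear_combination v g * hconserve g
    have hσ (c : R) (v : Bool × Bool → R) : c * K * ∑ g, v g * W g = ∑ g, c * v g * (K * W g) := by
      rw [Finset.mul_sum]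
      exact Finset.sum_congr rfl fun g _ => by ring
    have hσ_one := hσ 1
    simp only [one_mul] at hσ_one
    simp only [flipSum_succ, rowWeight, Fin.cons_zero, Fin.tail_cons, flipSum_sum_mul, ← ih,
      mul_add, Finset.sum_add_distrib, hprod, mul_ite, mul_zero, Finset.sum_ite_eq',
      Finset.mem_univ, if_true]
    rw [hτ, hσ, hσ_one]
    linear_combination hvertex

open Finset in
theorem flipCoeff_eq_pow (t : R) {m : ℕ} (σ : Fin m → Bool × Bool)
    (i : Fin m) : flipCoeff t σ i = (-1) ^ #{j ∈ Ioi i | (σ j).1 ≠ (σ j).2} *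
      t ^ #{j ∈ Ioi i | (σ j).2 = true} := by
  rw [flipCoeff, ← prod_const, ← prod_const, prod_filter, prod_filter,
    ← prod_mul_distrib]
  refine prod_congr rfl fun j _ => ?_
  rcases σ j with ⟨a, b⟩
  cases a <;> cases b <;> simp [flipFactor]

end Lattice

section Transfer

variable {R : Type*} [CommRing R]

/-- The row transfer matrix. -/
def rowMatrix (t : R) (m : ℕ) (x : R) : Matrix (Fin m → Bool × Bool) (Fin m → Bool × Bool) R :=
  fun σ τ => rowWeight t x σ τ (false, false)

/-- The matrix of the flip operator. -/
def flipMatrix (t : R) (m : ℕ) : Matrix (Fin m → Bool × Bool) (Fin m → Bool × Bool) R :=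
  fun σ ρ => ∑ i, if σ i = (true, false) ∧ ρ = Function.update σ i (false, true) then
    flipCoeff t σ i else 0

theorem flipCoeff_update (t : R) {m : ℕ} (σ : Fin m → Bool × Bool) (i : Fin m) (a : Bool × Bool) :
    flipCoeff t (Function.update σ i a) i = flipCoeff t σ i := by
  refine Finset.prod_congr rfl fun j hj => ?_
  rw [Function.update_of_ne (Finset.mem_Ioi.1 hj).ne']

theorem flipMatrix_mul_apply (t : R) {m : ℕ}
    (A : Matrix (Fin m → Bool × Bool) (Fin m → Bool × Bool) R) (σ τ : Fin m → Bool × Bool) :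
    (flipMatrix t m * A) σ τ = flipSum t (true, false) (false, true) σ fun ρ => A ρ τ := by
  simp only [Matrix.mul_apply, flipMatrix, Finset.sum_mul]
  rw [Finset.sum_comm]
  refine Finset.sum_congr rfl fun i _ => ?_
  by_cases hi : σ i = (true, false) <;> simp [hi]

theorem mul_flipMatrix_apply (t : R) {m : ℕ}
    (A : Matrix (Fin m → Bool × Bool) (Fin m → Bool × Bool) R) (σ τ : Fin m → Bool × Bool) :
    (A * flipMatrix t m) σ τ = flipSum t (false, true) (true, false) τ fun ρ => A σ ρ := by
  simp only [Matrix.mul_apply, flipMatrix, Finset.mul_sum]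
  rw [Finset.sum_comm]
  refine Finset.sum_congr rfl fun i _ => ?_
  have update_iff (ρ : Fin m → Bool × Bool) :
      ρ i = (true, false) ∧ τ = Function.update ρ i (false, true) ↔
        τ i = (false, true) ∧ ρ = Function.update τ i (true, false) := by
    constructor <;> rintro ⟨h, rfl⟩ <;> simp [← h]
  simp only [update_iff]
  by_cases hi : τ i = (false, true) <;> simp [hi, flipCoeff_update, mul_comm]

theorem commute_flipMatrix_rowMatrix (t : R) (m : ℕ) (x : R) :
    Commute (flipMatrix t m) (rowMatrix t m x) := by
  ext σ τ
  rw [flipMatrix_mul_apply, mul_flipMatrix_apply]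
  simpa [rowMatrix] using flipSum_rowWeight t x σ τ (false, false)

/-- The partition function of the lattice with one row for each entry of `x`, bottom boundary `σ`
and top boundary `τ`. -/
def partitionFunction (t : R) (m : ℕ) {n : ℕ} (x : Fin n → R) (σ τ : Fin m → Bool × Bool) : R :=
  (List.ofFn fun k => rowMatrix t m (x k)).prod σ τ

theorem flipSum_partitionFunction (t : R) (m : ℕ) {n : ℕ} (x : Fin n → R)
    (σ τ : Fin m → Bool × Bool) :
    flipSum t (true, false) (false, true) σ (fun ρ => partitionFunction t m x ρ τ) =
      flipSum t (false, true) (true, false) τ (fun ρ => partitionFunction t m x σ ρ) := by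
  have hcomm : Commute (flipMatrix t m) (List.ofFn fun k => rowMatrix t m (x k)).prod := by
    refine Commute.list_prod_right _ _ fun A hA => ?_
    obtain ⟨k, rfl⟩ := List.mem_ofFn.1 hA
    exact commute_flipMatrix_rowMatrix t m (x k)
  simpa only [flipMatrix_mul_apply, mul_flipMatrix_apply] using! congrFun₂ hcomm.eq σ τ

theorem list_ofFn_prod_apply {ι : Type*} [Fintype ι] [DecidableEq ι] {n : ℕ}
    (A : Fin n → Matrix ι ι R) (σ τ : ι) :
    (List.ofFn A).prod σ τ = ∑ g : Fin (n + 1) → ι,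
      if g 0 = σ ∧ g (Fin.last n) = τ then ∏ k, A k (g k.castSucc) (g k.succ) else 0 := by
  induction n generalizing σ with
  | zero =>
    rw [← (Equiv.funUnique (Fin 1) ι).symm.sum_comp]
    simp [Matrix.one_apply, ite_and]
  | succ n ih =>
    rw [List.ofFn_succ, List.prod_cons, Matrix.mul_apply,
      ← (Fin.consEquiv fun _ : Fin (n + 2) => ι).sum_comp, Fintype.sum_prod_type]
    simp only [ih, Finset.mul_sum, Fin.consEquiv, Equiv.coe_fn_mk, Fin.cons_zero, ite_and,
      Finset.sum_ite_irrel, Finset.sum_const_zero, Finset.sum_ite_eq', Finset.mem_univ, if_true]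
    rw [Finset.sum_comm]
    refine Finset.sum_congr rfl fun g _ => ?_
    simp [Fin.prod_univ_succ, ← Fin.succ_last]

end Transfer

section Strip

/-- The number of occupied columns with index at least `c`. -/
def countFrom {m : ℕ} (α : Fin m → Bool) (c : ℕ) : ℕ :=
  (Finset.univ.filter fun i : Fin m => c ≤ (i : ℕ) ∧ α i = true).card

theorem countFrom_succ_succ {m : ℕ} (α : Fin (m + 1) → Bool) (c : ℕ) :
    countFrom α (c + 1) = countFrom (Fin.tail α) c := by
  rw [countFrom, Fin.card_filter_univ_succ, if_neg (by simp)]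
  simp only [Fin.val_succ, Nat.add_le_add_iff_right]
  rfl

theorem countFrom_eq_add {m : ℕ} (α : Fin m → Bool) (c : Fin m) :
    countFrom α c = (α c).toNat + countFrom α (c + 1) := by
  simp only [countFrom, Finset.card_filter]
  rw [← Finset.add_sum_erase _ _ (Finset.mem_univ c),
    ← Finset.sum_erase (Finset.univ : Finset (Fin m)) (a := c) (by simp)]
  congr 1
  · cases α c <;> simp
  · refine Finset.sum_congr rfl fun i hi => ?_
    have := Fin.val_ne_of_ne (Finset.ne_of_mem_erase hi)
    simp only [Nat.succ_le_iff, lt_iff_le_and_ne, this.symm, ne_eq, not_false_eq_true, and_true]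

/-- The paths of one color can go through a row with bottom boundary `α`, top boundary `β` and left
boundary `h`. -/
def IsStrip {m : ℕ} (α β : Fin m → Bool) (h : Bool) : Prop :=
  countFrom β 0 = countFrom α 0 + h.toNat ∧
    ∀ c, countFrom α c ≤ countFrom β c ∧ countFrom β c ≤ countFrom α (c + 1) + 1

/-- The number of paths on the edge to the left of column `c`. -/
def edgeCount {m : ℕ} (α β : Fin m → Bool) (c : ℕ) : ℕ := countFrom β c - countFrom α c

theorem isStrip_fin_zero (α β : Fin 0 → Bool) (h : Bool) : IsStrip α β h ↔ h = false := by
  cases h <;> simp [IsStrip, countFrom]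

theorem IsStrip.unique {m : ℕ} {α β : Fin m → Bool} {g h : Bool} (hg : IsStrip α β g)
    (hh : IsStrip α β h) : g = h := by
  have := hg.1.symm.trans hh.1
  cases g <;> cases h <;> simp at this ⊢

theorem IsStrip.edgeCount_one {m : ℕ} {α β : Fin (m + 1) → Bool} {g : Bool}
    (hg : IsStrip (Fin.tail α) (Fin.tail β) g) : edgeCount α β 1 = g.toNat := by
  rw [edgeCount, countFrom_succ_succ _ 0, countFrom_succ_succ _ 0, hg.1, Nat.add_sub_cancel_left]

theorem IsStrip.countFrom_zero_sub {m : ℕ} {α β : Fin (m + 1) → Bool} {h : Bool}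
    (hs : IsStrip α β h) : countFrom β 0 - countFrom α 1 = h.toNat + (α 0).toNat := by
  have := countFrom_eq_add α 0
  simp only [Fin.val_zero, zero_add] at this
  have := hs.1
  omega

theorem isStrip_succ {m : ℕ} (α β : Fin (m + 1) → Bool) (h : Bool) :
    IsStrip α β h ↔ ∃ g : Bool, (h.toNat + (α 0).toNat = (β 0).toNat + g.toNat ∧
      h.toNat + (α 0).toNat ≤ 1) ∧ IsStrip (Fin.tail α) (Fin.tail β) g := by
  have eα := countFrom_eq_add α 0
  have eβ := countFrom_eq_add β 0
  simp only [Fin.val_zero, zero_add] at eα eβ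
  simp only [IsStrip, ← countFrom_succ_succ, zero_add]
  constructor
  · rintro ⟨hle, hs⟩
    have hs0 := hs 0
    have hs1 := hs 1
    simp only [zero_add] at hs0
    have hh := Bool.toNat_le h
    have ha := Bool.toNat_le (α 0)
    have hb := Bool.toNat_le (β 0)
    refine ⟨decide (countFrom α 1 < countFrom β 1), ?_⟩
    by_cases hlt : countFrom α 1 < countFrom β 1 <;>
      simp only [hlt, decide_true, decide_false, Bool.toNat_true, Bool.toNat_false] <;>
      exact ⟨⟨by omega, by omega⟩, by omega, fun c => hs (c + 1)⟩
  · rintro ⟨g, ⟨hconserve, hexclude⟩, htail, hs⟩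
    refine ⟨by omega, fun c => ?_⟩
    rcases c with _ | c
    · have := hs 0
      simp only [zero_add] at this ⊢
      omega
    · exact hs c

open Classical in
theorem rowWeight_eq {R : Type*} [CommRing R] (t x : R) {m : ℕ} (σ τ : Fin m → Bool × Bool)
    (h : Bool × Bool) :
    rowWeight t x σ τ h =
      if IsStrip (fun i => (σ i).1) (fun i => (τ i).1) h.1 ∧
          IsStrip (fun i => (σ i).2) (fun i => (τ i).2) h.2 then
        ∏ c : Fin m,
          x ^ (edgeCount (fun i => (σ i).1) (fun i => (τ i).1) (c + 1) +
            edgeCount (fun i => (σ i).2) (fun i => (τ i).2) (c + 1)) *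
          t ^ (edgeCount (fun i => (σ i).1) (fun i => (τ i).1) (c + 1) *
            (countFrom (fun i => (τ i).2) c - countFrom (fun i => (σ i).2) (c + 1)))
      else 0 := by
  induction m generalizing h with
  | zero => simp [rowWeight, isStrip_fin_zero, Prod.ext_iff]
  | succ m ih =>
    rw [rowWeight]
    split_ifs with hs
    · obtain ⟨⟨g₁, hv₁, hs₁⟩, ⟨g₂, hv₂, hs₂⟩⟩ :=
        And.intro ((isStrip_succ _ _ _).1 hs.1) ((isStrip_succ _ _ _).1 hs.2)
      rw [Finset.sum_eq_single (g₁, g₂) (fun g _ hg => ?_) (by simp), ih, if_pos ⟨hs₁, hs₂⟩,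
        vertexWeight, if_pos ⟨hv₁.1, hv₁.2, hv₂⟩, Fin.prod_univ_succ]
      · simp only [Fin.val_zero, zero_add, hs₁.edgeCount_one, hs₂.edgeCount_one,
          hs.2.countFrom_zero_sub]
        simp only [edgeCount, Fin.val_succ, countFrom_succ_succ]
        rfl
      · rw [ih, if_neg, mul_zero]
        exact fun h => hg (Prod.ext (h.1.unique hs₁) (h.2.unique hs₂))
    · refine Finset.sum_eq_zero fun g _ => ?_
      rw [ih, vertexWeight]
      split_ifs with hv htail
      · exact absurd ⟨(isStrip_succ _ _ _).2 ⟨g.1, ⟨hv.1, hv.2.1⟩, htail.1⟩,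
          (isStrip_succ _ _ _).2 ⟨g.2, hv.2.2, htail.2⟩⟩ hs
      all_goals simp

end Strip

namespace SkewPartition

variable {S : SkewPartition} {n : ℕ}

/-- The length of the part of the row `i` filled with letters of index less than `k`, as the column
of its last cell. -/
def level (T : S.Tableau n) (k : ℕ) (i : Fin S.len) : ℕ :=
  max (S.inner i) (Finset.univ.sup fun j : Finset.Ioc (S.inner i) (S.outer i) =>
    if (T.1 ⟨i, j⟩ : ℕ) < k then (j : ℕ) else 0)

theorem inner_le_level (T : S.Tableau n) (k : ℕ) (i : Fin S.len) : S.inner i ≤ level T k i :=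
  le_max_left _ _

theorem level_le_outer (T : S.Tableau n) (k : ℕ) (i : Fin S.len) : level T k i ≤ S.outer i := by
  refine max_le (S.inner_le_outer i) (Finset.sup_le fun j _ => ?_)
  split_ifs
  · exact (Finset.mem_Ioc.1 j.2).2
  · exact Nat.zero_le _

theorem le_level_iff (T : S.Tableau n) (k : ℕ) (i : Fin S.len)
    (j : Finset.Ioc (S.inner i) (S.outer i)) : (j : ℕ) ≤ level T k i ↔ (T.1 ⟨i, j⟩ : ℕ) < k := by
  have hj := Finset.mem_Ioc.1 j.2
  constructor
  · intro h
    rcases le_max_iff.1 h with h | h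
    · omega
    · obtain ⟨j', -, hj'⟩ := (Finset.le_sup_iff (show (⊥ : ℕ) < j from by
        rw [Nat.bot_eq_zero]; omega)).1 h
      split_ifs at hj' with hlt
      · have := T.2.1 ⟨i, j⟩ ⟨i, j'⟩ rfl hj'
        exact lt_of_le_of_lt (by exact_mod_cast this) hlt
      · omega
  · intro h
    refine le_max_of_le_right ?_
    have := Finset.le_sup (f := fun j : Finset.Ioc (S.inner i) (S.outer i) =>
      if (T.1 ⟨i, j⟩ : ℕ) < k then (j : ℕ) else 0) (Finset.mem_univ j)
    simpa [h] using this

theorem level_mono (T : S.Tableau n) {k l : ℕ} (hkl : k ≤ l) (i : Fin S.len) :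
    level T k i ≤ level T l i := by
  by_cases h : level T k i ≤ S.inner i
  · exact h.trans (inner_le_level T l i)
  · have hj : level T k i ∈ Finset.Ioc (S.inner i) (S.outer i) :=
      Finset.mem_Ioc.2 ⟨not_le.1 h, level_le_outer T k i⟩
    exact (le_level_iff T l i ⟨_, hj⟩).2 (((le_level_iff T k i ⟨_, hj⟩).1 le_rfl).trans_le hkl)

theorem level_interlace (T : S.Tableau n) (k : ℕ) {i i' : Fin S.len} (hi : i < i') :
    level T (k + 1) i' ≤ level T k i := by
  by_cases h : level T (k + 1) i' ≤ S.inner i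
  · exact h.trans (inner_le_level T k i)
  · have hb := level_le_outer T (k + 1) i'
    have h' : level T (k + 1) i' ∈ Finset.Ioc (S.inner i') (S.outer i') :=
      Finset.mem_Ioc.2 ⟨(S.inner_antitone hi.le).trans_lt (not_le.1 h), hb⟩
    have hj : level T (k + 1) i' ∈ Finset.Ioc (S.inner i) (S.outer i) :=
      Finset.mem_Ioc.2 ⟨not_le.1 h, hb.trans (S.outer_antitone hi.le)⟩
    have hletter := (le_level_iff T (k + 1) i' ⟨_, h'⟩).1 le_rfl
    have hcolumn := T.2.2 ⟨i, ⟨_, hj⟩⟩ ⟨i', ⟨_, h'⟩⟩ hi rfl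
    exact (le_level_iff T k i ⟨_, hj⟩).2 (by omega)

theorem level_antitone (T : S.Tableau n) (k : ℕ) : Antitone (level T k) := by
  intro i i' h
  rcases h.eq_or_lt with rfl | h
  · exact le_rfl
  · exact (level_mono T (Nat.le_succ k) i').trans (level_interlace T k h)

theorem level_zero (T : S.Tableau n) : level T 0 = S.inner := by
  ext i
  refine le_antisymm ?_ (inner_le_level T 0 i)
  by_contra h
  have hj : level T 0 i ∈ Finset.Ioc (S.inner i) (S.outer i) :=
    Finset.mem_Ioc.2 ⟨not_le.1 h, level_le_outer T 0 i⟩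
  exact absurd ((le_level_iff T 0 i ⟨_, hj⟩).1 le_rfl) (Nat.not_lt_zero _)

theorem level_last (T : S.Tableau n) : level T n = S.outer := by
  ext i
  refine le_antisymm (level_le_outer T n i) ?_
  rcases (S.inner_le_outer i).eq_or_lt with h | h
  · rw [← h]; exact inner_le_level T n i
  · exact (le_level_iff T n i ⟨S.outer i, Finset.mem_Ioc.2 ⟨h, le_rfl⟩⟩).2 (Fin.is_lt _)

end SkewPartition

section Chains

/-- The occupied columns of a row boundary in the window `0, …, m - 1`, where the part `p i` puts
a path in the column `p i - i + L`. -/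
def pathState (L m : ℕ) {l : ℕ} (p : Fin l → ℕ) : Fin m → Bool :=
  fun c => decide (∃ i : Fin l, p i + (L - i) = c)

variable {L m l : ℕ} {p : Fin l → ℕ}

theorem pathIndex_strictAnti (hL : l ≤ L) (hp : Antitone p) :
    StrictAnti fun i : Fin l => p i + (L - i) := by
  intro i j hij
  have hparts := hp hij.le
  change p j + (L - j) < p i + (L - i)
  omega

theorem countFrom_pathState (hL : l ≤ L) (hp : Antitone p) (hm : ∀ i, p i + L < m) (c : ℕ) :
    countFrom (pathState L m p) c =
      (Finset.univ.filter fun i : Fin l => c ≤ p i + (L - i)).card := by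
  symm
  have hlt : ∀ i, p i + (L - i) < m := fun i => by have := hm i; omega
  refine Finset.card_bij (fun i _ => ⟨p i + (L - i), hlt i⟩) ?_ ?_ ?_
  · intro i hi
    simpa [pathState] using (Finset.mem_filter.1 hi).2
  · intro i _ j _ h
    exact (pathIndex_strictAnti hL hp).injective (Fin.mk.inj h)
  · intro c' hc'
    simp only [Finset.mem_filter, Finset.mem_univ, true_and, pathState, decide_eq_true_eq] at hc'
    obtain ⟨hle, i, hi⟩ := hc'
    exact ⟨i, by simp [hi, hle], Fin.ext hi⟩

theorem countFrom_pathState_le_iff (hL : l ≤ L) (hp : Antitone p) (hm : ∀ i, p i + L < m) (c : ℕ)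
    (i : Fin l) : countFrom (pathState L m p) c ≤ i ↔ p i + (L - i) < c := by
  rw [countFrom_pathState hL hp hm]
  have hanti := pathIndex_strictAnti hL hp
  constructor
  · intro h
    by_contra hcon
    have hsub : Finset.Iic i ⊆ Finset.univ.filter fun i : Fin l => c ≤ p i + (L - i) := by
      intro i' hi'
      have : p i + (L - i) ≤ p i' + (L - i') := hanti.antitone (Finset.mem_Iic.1 hi')
      exact Finset.mem_filter.2 ⟨Finset.mem_univ _, by omega⟩
    have := Finset.card_le_card hsub
    rw [Fin.card_Iic] at this
    omega
  · intro h
    have hsub : (Finset.univ.filter fun i : Fin l => c ≤ p i + (L - i)) ⊆ Finset.Iio i := by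
      intro i' hi'
      have := (Finset.mem_filter.1 hi').2
      rw [Finset.mem_Iio]
      by_contra hcon
      have : p i' + (L - i') ≤ p i + (L - i) := hanti.antitone (not_lt.1 hcon)
      omega
    have := Finset.card_le_card hsub
    rwa [Fin.card_Iio] at this

theorem countFrom_pathState_le (hL : l ≤ L) (hp : Antitone p) (hm : ∀ i, p i + L < m) (c : ℕ) :
    countFrom (pathState L m p) c ≤ l := by
  rw [countFrom_pathState hL hp hm]
  exact (Finset.card_filter_le _ _).trans (by simp)

theorem countFrom_le_succ {m : ℕ} (α : Fin m → Bool) (c : ℕ) :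
    countFrom α c ≤ countFrom α (c + 1) + 1 := by
  by_cases h : c < m
  · have := countFrom_eq_add α ⟨c, h⟩
    have hbit := Bool.toNat_le (α ⟨c, h⟩)
    simp only at this
    omega
  · have : countFrom α c = 0 := by
      rw [countFrom, Finset.card_eq_zero, Finset.filter_eq_empty_iff]
      intro i _ hi
      have := i.2
      omega
    omega

theorem countFrom_antitone {m : ℕ} (α : Fin m → Bool) : Antitone (countFrom α) := by
  intro c d h
  refine Finset.card_le_card fun i hi => ?_
  rw [Finset.mem_filter] at hi ⊢
  exact ⟨hi.1, by omega, hi.2.2⟩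

theorem countFrom_le_add {m : ℕ} (α : Fin m → Bool) (c d : ℕ) :
    countFrom α c ≤ countFrom α (c + d) + d := by
  induction d with
  | zero => simp
  | succ d ih =>
    have := countFrom_le_succ α (c + d)
    rw [show c + (d + 1) = c + d + 1 from rfl]
    omega

theorem eq_of_countFrom_eq {m : ℕ} {α β : Fin m → Bool} (h : ∀ c, countFrom α c = countFrom β c) :
    α = β := by
  ext c
  have hα := countFrom_eq_add α c
  have hβ := countFrom_eq_add β c
  rw [h c, h (c + 1), hβ, add_left_inj] at hα
  cases hαc : α c <;> cases hβc : β c <;> simp_all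

open SkewPartition

variable {S : SkewPartition} {n : ℕ}

/-- The chain of row boundaries of a tableau. -/
def tableauChain (L m : ℕ) (T : S.Tableau n) (k : Fin (n + 1)) : Fin m → Bool :=
  pathState L m (level T k)

theorem inner_add_lt (hm : ∀ i, S.outer i + L < m) (i : Fin S.len) : S.inner i + L < m :=
  (Nat.add_le_add_right (S.inner_le_outer i) L).trans_lt (hm i)

theorem level_add_lt (hm : ∀ i, S.outer i + L < m) (T : S.Tableau n) (k : ℕ) (i : Fin S.len) :
    level T k i + L < m := by
  have := hm i
  have := level_le_outer T k i
  omega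

theorem lt_iff_lt_countFrom (hL : S.len ≤ L) (hm : ∀ i, S.outer i + L < m) (T : S.Tableau n)
    (k : Fin (n + 1)) (v : S.Cell) :
    (T.1 v : ℕ) < k ↔ (v.1 : ℕ) < countFrom (tableauChain L m T k) (v.2 + (L - v.1)) := by
  obtain ⟨i, j⟩ := v
  rw [← le_level_iff, ← not_le (b := (i : ℕ)), tableauChain, countFrom_pathState_le_iff hL
    (level_antitone T k) (level_add_lt hm T k)]
  simp

theorem tableauChain_injective (hL : S.len ≤ L) (hm : ∀ i, S.outer i + L < m) :
    Function.Injective (tableauChain L m : S.Tableau n → Fin (n + 1) → Fin m → Bool) := by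
  intro T T' h
  have hiff : ∀ (v : S.Cell) (k : Fin (n + 1)), (T.1 v : ℕ) < k ↔ (T'.1 v : ℕ) < k := fun v k => by
    rw [lt_iff_lt_countFrom hL hm T, lt_iff_lt_countFrom hL hm T', h]
  refine Subtype.ext (funext fun v => Fin.ext ?_)
  have hle' := (hiff v ⟨T.1 v + 1, by omega⟩).1 (by simp)
  have hle := (hiff v ⟨T'.1 v + 1, by omega⟩).2 (by simp)
  simp only at hle hle'
  omega

/-- The chains of row boundaries that come from tableaux. -/
def IsBoundaryChain (S : SkewPartition) (L : ℕ) {m n : ℕ} (g : Fin (n + 1) → Fin m → Bool) : Prop :=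
  g 0 = pathState L m S.inner ∧ g (Fin.last n) = pathState L m S.outer ∧
    ∀ k : Fin n, IsStrip (g k.castSucc) (g k.succ) false

theorem tableauChain_isBoundaryChain (hL : S.len ≤ L) (hm : ∀ i, S.outer i + L < m)
    (T : S.Tableau n) : IsBoundaryChain S L (tableauChain L m T) := by
  refine ⟨?_, ?_, fun k => ⟨?_, fun c => ⟨?_, ?_⟩⟩⟩
  · rw [tableauChain, Fin.val_zero, level_zero]
  · rw [tableauChain, Fin.val_last, level_last]
  all_goals
    simp only [tableauChain, Fin.val_castSucc, Fin.val_succ]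
  · rw [countFrom_pathState hL (level_antitone T _) (level_add_lt hm T _),
      countFrom_pathState hL (level_antitone T _) (level_add_lt hm T _)]
    simp
  · rw [countFrom_pathState hL (level_antitone T _) (level_add_lt hm T _),
      countFrom_pathState hL (level_antitone T _) (level_add_lt hm T _)]
    refine Finset.card_le_card fun i hi => ?_
    rw [Finset.mem_filter] at hi ⊢
    have := level_mono T (show (k : ℕ) ≤ k + 1 by omega) i
    exact ⟨hi.1, by omega⟩
  · set N := countFrom (pathState L m (level T k)) (c + 1) with hN
    have hle := countFrom_pathState_le hL (level_antitone T (k + 1)) (level_add_lt hm T (k + 1)) c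
    by_cases hlen : N + 1 < S.len
    · have hlt := (countFrom_pathState_le_iff hL (level_antitone T k) (level_add_lt hm T k) (c + 1)
        ⟨N, by omega⟩).1 hN.ge
      have hinterlace := level_interlace T k (i := ⟨N, by omega⟩) (i' := ⟨N + 1, hlen⟩)
        (Fin.mk_lt_mk.2 (Nat.lt_succ_self N))
      refine (countFrom_pathState_le_iff hL (level_antitone T (k + 1)) (level_add_lt hm T (k + 1)) c
        ⟨N + 1, hlen⟩).2 ?_
      simp only at hlt ⊢
      omega
    · omega

theorem card_filter_succ_le_lt_iff {N : Fin (n + 1) → ℕ} (hN : Monotone N) {r : ℕ} (h0 : N 0 ≤ r)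
    (k : Fin (n + 1)) : (Finset.univ.filter fun k : Fin n => N k.succ ≤ r).card < k ↔ r < N k := by
  constructor
  · intro h
    by_contra! hk
    have hsub : (Finset.univ.filter fun k' : Fin n => (k' : ℕ) < k) ⊆
        Finset.univ.filter fun k : Fin n => N k.succ ≤ r :=
      Finset.monotone_filter_right _ fun k' _ hk' =>
        (hN (Nat.succ_le_of_lt hk')).trans hk
    have := Finset.card_le_card hsub
    rw [Fin.card_filter_val_lt] at this
    omega
  · intro h
    obtain ⟨k, rfl⟩ := Fin.exists_succ_eq.2 (show k ≠ 0 by rintro rfl; omega)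
    have hsub : (Finset.univ.filter fun k : Fin n => N k.succ ≤ r) ⊆
        Finset.univ.filter fun k' : Fin n => (k' : ℕ) < k := by
      refine Finset.monotone_filter_right _ fun k' _ hk' => ?_
      by_contra! hle
      exact absurd ((hN (Fin.succ_le_succ_iff.2 hle)).trans hk') (not_le.2 h)
    have := Finset.card_le_card hsub
    rw [Fin.card_filter_val_lt] at this
    simp only [Fin.val_succ]
    omega

namespace IsBoundaryChain

variable {g g' : Fin (n + 1) → Fin m → Bool}

theorem countFrom_mono (hg : IsBoundaryChain S L g) (c : ℕ) :
    Monotone fun k => countFrom (g k) c :=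
  Fin.monotone_iff_le_succ.2 fun k => ((hg.2.2 k).2 c).1

theorem lt_countFrom (hg : IsBoundaryChain S L g) (hL : S.len ≤ L)
    (hm : ∀ i, S.outer i + L < m) {c : ℕ} {i : Fin S.len} (hc : c ≤ S.inner i + (L - i))
    (k : Fin (n + 1)) : (i : ℕ) < countFrom (g k) c := by
  refine lt_of_lt_of_le ?_ (hg.countFrom_mono c (Fin.zero_le k))
  simp only
  rw [hg.1, ← not_le, countFrom_pathState_le_iff hL S.inner_antitone (inner_add_lt hm)]
  omega

theorem countFrom_le (hg : IsBoundaryChain S L g) (hL : S.len ≤ L)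
    (hm : ∀ i, S.outer i + L < m) {c : ℕ} {i : Fin S.len} (hc : S.outer i + (L - i) < c)
    (k : Fin (n + 1)) : countFrom (g k) c ≤ i := by
  refine (hg.countFrom_mono c (Fin.le_last k)).trans ?_
  simp only
  rwa [hg.2.1, countFrom_pathState_le_iff hL S.outer_antitone hm]

theorem countFrom_le_len (hg : IsBoundaryChain S L g) (hL : S.len ≤ L)
    (hm : ∀ i, S.outer i + L < m) (c : ℕ) (k : Fin (n + 1)) : countFrom (g k) c ≤ S.len := by
  refine (hg.countFrom_mono c (Fin.le_last k)).trans ?_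
  simp only
  rw [hg.2.1]
  exact countFrom_pathState_le hL S.outer_antitone hm c

theorem ext_of_cells (hg : IsBoundaryChain S L g) (hg' : IsBoundaryChain S L g')
    (hL : S.len ≤ L) (hm : ∀ i, S.outer i + L < m)
    (h : ∀ (k : Fin (n + 1)) (v : S.Cell), (v.1 : ℕ) < countFrom (g k) (v.2 + (L - v.1)) ↔
      (v.1 : ℕ) < countFrom (g' k) (v.2 + (L - v.1))) : g = g' := by
  refine funext fun k => eq_of_countFrom_eq fun c => ?_
  have hlt (i : Fin S.len) : (i : ℕ) < countFrom (g k) c ↔ (i : ℕ) < countFrom (g' k) c := by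
    rcases le_or_gt c (S.inner i + (L - i)) with hc | hc
    · exact iff_of_true (hg.lt_countFrom hL hm hc k) (hg'.lt_countFrom hL hm hc k)
    rcases lt_or_ge (S.outer i + (L - i)) c with hc' | hc'
    · exact iff_of_false (hg.countFrom_le hL hm hc' k).not_gt (hg'.countFrom_le hL hm hc' k).not_gt
    · have hj : c - (L - i) ∈ Finset.Ioc (S.inner i) (S.outer i) :=
        Finset.mem_Ioc.2 ⟨by omega, by omega⟩
      have hv := h k ⟨i, ⟨_, hj⟩⟩
      rwa [show c - (L - i) + (L - (i : ℕ)) = c by omega] at hv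
  have hle := hg.countFrom_le_len hL hm c k
  have hle' := hg'.countFrom_le_len hL hm c k
  by_contra hne
  rcases lt_or_gt_of_ne hne with hlt' | hlt'
  · exact absurd ((hlt ⟨_, hlt'.trans_le hle'⟩).2 hlt') (lt_irrefl _)
  · exact absurd ((hlt ⟨_, hlt'.trans_le hle⟩).1 hlt') (lt_irrefl _)

end IsBoundaryChain

/-- The letter in the cell `v` of the tableau with the chain of row boundaries `g`, as an index
from `0`: the number of the row boundaries after the first that have not yet passed `v`. -/
def chainLetter (L : ℕ) (g : Fin (n + 1) → Fin m → Bool) (v : S.Cell) : ℕ :=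
  (Finset.univ.filter fun k : Fin n => countFrom (g k.succ) (v.2 + (L - v.1)) ≤ v.1).card

namespace IsBoundaryChain

variable {g : Fin (n + 1) → Fin m → Bool}

theorem chainLetter_lt_iff (hg : IsBoundaryChain S L g) (hL : S.len ≤ L)
    (hm : ∀ i, S.outer i + L < m) (v : S.Cell) (k : Fin (n + 1)) :
    chainLetter L g v < k ↔ (v.1 : ℕ) < countFrom (g k) (v.2 + (L - v.1)) := by
  refine card_filter_succ_le_lt_iff (hg.countFrom_mono _) ?_ k
  rw [hg.1, countFrom_pathState_le_iff hL S.inner_antitone (inner_add_lt hm)]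
  have := (Finset.mem_Ioc.1 v.2.2).1
  omega

theorem chainLetter_lt (hg : IsBoundaryChain S L g) (hL : S.len ≤ L)
    (hm : ∀ i, S.outer i + L < m) (v : S.Cell) : chainLetter L g v < n := by
  refine (hg.chainLetter_lt_iff hL hm v (Fin.last n)).2 ?_
  rw [hg.2.1, ← not_le, countFrom_pathState_le_iff hL S.outer_antitone hm]
  have := (Finset.mem_Ioc.1 v.2.2).2
  omega

theorem isSemistandard_chainLetter (hg : IsBoundaryChain S L g) (hL : S.len ≤ L)
    (hm : ∀ i, S.outer i + L < m) :
    S.IsSemistandard fun v => (⟨chainLetter L g v, hg.chainLetter_lt hL hm v⟩ : Fin n) := by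
  constructor
  · rintro ⟨i, j⟩ ⟨_, j'⟩ rfl hj
    set k : Fin n := ⟨_, hg.chainLetter_lt hL hm ⟨i, j'⟩⟩ with hk
    have hj' := (hg.chainLetter_lt_iff hL hm ⟨i, j'⟩ k.succ).1 (by simp [hk])
    have := (hg.chainLetter_lt_iff hL hm ⟨i, j⟩ k.succ).2 (hj'.trans_le
      (countFrom_antitone _ (Nat.add_le_add_right hj _)))
    exact Nat.lt_succ_iff.1 this
  · rintro ⟨i, j⟩ ⟨i', j'⟩ hi hj
    simp only at hi hj
    set k : Fin n := ⟨_, hg.chainLetter_lt hL hm ⟨i', j'⟩⟩ with hk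
    have hi' := (hg.chainLetter_lt_iff hL hm ⟨i', j'⟩ k.succ).1 (by simp [hk])
    have hstrip := ((hg.2.2 k).2 (j' + (L - i'))).2
    have hadd := countFrom_le_add (g k.castSucc) (j' + (L - i') + 1) (i' - i - 1)
    rw [show (j' : ℕ) + (L - i') + 1 + (i' - i - 1) = j + (L - i) by omega] at hadd
    exact (hg.chainLetter_lt_iff hL hm ⟨i, j⟩ k.castSucc).2 (by simp only at hi' ⊢; omega)

theorem exists_tableau (hg : IsBoundaryChain S L g) (hL : S.len ≤ L)
    (hm : ∀ i, S.outer i + L < m) : ∃ T : S.Tableau n, tableauChain L m T = g := by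
  refine ⟨⟨_, hg.isSemistandard_chainLetter hL hm⟩, ?_⟩
  refine (tableauChain_isBoundaryChain hL hm _).ext_of_cells hg hL hm fun k v => ?_
  rw [← lt_iff_lt_countFrom hL hm, ← hg.chainLetter_lt_iff hL hm]

end IsBoundaryChain

end Chains

section LatticeLLT

open SkewPartition

variable {S S₁ S₂ : SkewPartition} {n L m : ℕ}

/-- The cells with the letter `k` whose path step ends in the lattice column `c`. -/
def cellsAt (L : ℕ) (T : S.Tableau n) (k : Fin n) (c : ℕ) : Finset S.Cell :=
  Finset.univ.filter fun v => T.1 v = k ∧ (v.2 : ℕ) + (L - v.1) = c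

/-- The rows of the shape whose path visits the lattice column `c` in the lattice row `k`. -/
def rowsAt (L : ℕ) (T : S.Tableau n) (k c : ℕ) : Finset (Fin S.len) :=
  Finset.univ.filter fun r => level T k r + (L - r) ≤ c ∧ c ≤ level T (k + 1) r + (L - r)

theorem filter_level_subset (T : S.Tableau n) (k : ℕ) {c d : ℕ} (hcd : c ≤ d) :
    (Finset.univ.filter fun r : Fin S.len => d ≤ level T k r + (L - r)) ⊆
      Finset.univ.filter fun r : Fin S.len => c ≤ level T (k + 1) r + (L - r) :=
  Finset.monotone_filter_right _ fun r _ hr =>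
    hcd.trans (hr.trans (Nat.add_le_add_right (level_mono T k.le_succ r) _))

theorem edgeCount_tableauChain (hL : S.len ≤ L) (hm : ∀ i, S.outer i + L < m) (T : S.Tableau n)
    (k : Fin n) (c : ℕ) :
    edgeCount (tableauChain L m T k.castSucc) (tableauChain L m T k.succ) c =
      (cellsAt L T k c).card := by
  simp only [edgeCount, tableauChain, Fin.val_castSucc, Fin.val_succ]
  rw [countFrom_pathState hL (level_antitone T _) (level_add_lt hm T _),
    countFrom_pathState hL (level_antitone T _) (level_add_lt hm T _),
    ← Finset.card_sdiff_of_subset (filter_level_subset T k le_rfl)]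
  refine (Finset.card_bij (fun v _ => v.1) ?_ ?_ ?_).symm
  · rintro ⟨i, j⟩ hv
    obtain ⟨-, hletter, hcol⟩ := Finset.mem_filter.1 hv
    have hlt := le_level_iff T k i j
    have hle := le_level_iff T (k + 1) i j
    simp only [hletter, lt_self_iff_false, iff_false, Nat.lt_succ_self, iff_true] at hlt hle hcol
    simp only [Finset.mem_sdiff, Finset.mem_filter, Finset.mem_univ, true_and]
    omega
  · rintro ⟨i, j⟩ hv ⟨i', j'⟩ hv' rfl
    simp only [cellsAt, Finset.mem_filter, Finset.mem_univ, true_and] at hv hv'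
    rw [show j = j' from Subtype.ext (by omega)]
  · intro i hi
    simp only [Finset.mem_sdiff, Finset.mem_filter, Finset.mem_univ, true_and] at hi
    have hinner := inner_le_level T k i
    have houter := level_le_outer T (k + 1) i
    have hj : c - (L - i) ∈ Finset.Ioc (S.inner i) (S.outer i) :=
      Finset.mem_Ioc.2 ⟨by omega, by omega⟩
    have hlt := (le_level_iff T (k + 1) i ⟨_, hj⟩).1 (by simp only; omega)
    have hle := mt (le_level_iff T k i ⟨_, hj⟩).2 (by simp only; omega)
    exact ⟨⟨i, ⟨_, hj⟩⟩, Finset.mem_filter.2 ⟨Finset.mem_univ _, Fin.ext (by omega),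
      by simp only; omega⟩, rfl⟩

theorem countFrom_sub_countFrom_tableauChain (hL : S.len ≤ L) (hm : ∀ i, S.outer i + L < m)
    (T : S.Tableau n) (k : Fin n) (c : ℕ) :
    countFrom (tableauChain L m T k.succ) c - countFrom (tableauChain L m T k.castSucc) (c + 1) =
      (rowsAt L T k c).card := by
  simp only [tableauChain, Fin.val_castSucc, Fin.val_succ]
  rw [countFrom_pathState hL (level_antitone T _) (level_add_lt hm T _),
    countFrom_pathState hL (level_antitone T _) (level_add_lt hm T _),
    ← Finset.card_sdiff_of_subset (filter_level_subset T k c.le_succ)]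
  congr 1
  ext r
  simp only [rowsAt, Finset.mem_sdiff, Finset.mem_filter, Finset.mem_univ, true_and]
  omega

theorem prod_cellsAt {M : Type*} [CommMonoid M] (hm : ∀ i, S.outer i + L < m) (T : S.Tableau n)
    (F : S.Cell → M) : ∏ k : Fin n, ∏ c : Fin m, ∏ v ∈ cellsAt L T k (c + 1), F v = ∏ v, F v := by
  have hlt (v : S.Cell) : (v.2 : ℕ) + (L - v.1) - 1 < m := by
    have := hm v.1
    have := Finset.mem_Ioc.1 v.2.2
    omega
  rw [← Finset.prod_fiberwise (s := Finset.univ)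
    (g := fun v : S.Cell => ((T.1 v, ⟨_, hlt v⟩) : Fin n × Fin m)), Fintype.prod_prod_type]
  refine Finset.prod_congr rfl fun k _ => Finset.prod_congr rfl fun c _ =>
    Finset.prod_congr ?_ fun _ _ => rfl
  ext v
  have := Finset.mem_Ioc.1 v.2.2
  simp only [cellsAt, Finset.mem_filter, Finset.mem_univ, true_and, Prod.mk.injEq, Fin.ext_iff]
  omega

theorem entryOrZero_le_iff (T : S.Tableau n) (r : Fin S.len) {j : ℕ}
    (hj : j ∈ Finset.Icc (S.inner r) (S.outer r)) (k : Fin n) :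
    entryOrZero T r j ≤ (((k : ℕ) + 1 : ℕ) : ℕ∞) ↔ j ≤ level T (k + 1) r := by
  rw [Finset.mem_Icc] at hj
  rw [entryOrZero]
  split_ifs with h
  · rw [Nat.cast_le, ← Nat.lt_succ_iff, Nat.succ_eq_add_one, add_lt_add_iff_right]
    exact (le_level_iff T (k + 1) r ⟨j, h⟩).symm
  · have := inner_le_level T (k + 1) r
    rw [Finset.mem_Ioc] at h
    exact iff_of_true zero_le (by omega)

theorem le_entryOrTop_iff (T : S.Tableau n) (r : Fin S.len) {j : ℕ}
    (hj : j ∈ Finset.Icc (S.inner r) (S.outer r)) (k : Fin n) :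
    (((k : ℕ) + 1 : ℕ) : ℕ∞) ≤ entryOrTop T r (j + 1) ↔ level T k r ≤ j := by
  rw [Finset.mem_Icc] at hj
  rw [entryOrTop]
  split_ifs with h
  · rw [Nat.cast_le, add_le_add_iff_right, ← not_lt, ← le_level_iff T k r ⟨j + 1, h⟩,
      Nat.succ_le_iff, not_lt]
  · have := level_le_outer T k r
    rw [Finset.mem_Ioc] at h
    exact iff_of_true le_top (by omega)

/-- The number of coinversions of a pair of tableaux, counted by the cells of the first one. -/
def pairCoinv (L : ℕ) (T₁ : S₁.Tableau n) (T₂ : S₂.Tableau n) : ℕ :=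
  ∑ v : S₁.Cell, (rowsAt L T₂ (T₁.1 v) (v.2 + (L - v.1) - 1)).card

section Coinv

variable {S : Fin 2 → SkewPartition} (T : TableauTuple S n)

theorem isTriple_and_isCoinversion_iff (hL : ∀ p, (S p).len ≤ L) (v : (S 0).Cell)
    (r : Fin (S 1).len) (j : Finset.Icc ((S 1).inner r) ((S 1).outer r)) :
    IsTriple (⟨0, 1, v, r, j⟩ : TripleData S) ∧ IsCoinversion T ⟨0, 1, v, r, j⟩ ↔
      (j : ℕ) + (L - r) = v.2 + (L - v.1) - 1 ∧
        r ∈ rowsAt L (T 1) ((T 0).1 v) (v.2 + (L - v.1) - 1) := by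
  have hL₀ := hL 0
  have hL₁ := hL 1
  have hv := Finset.mem_Ioc.1 v.2.2
  have hv₁ := v.1.2
  have hr := r.2
  simp only [IsTriple, IsCoinversion, Fin.zero_lt_one, true_and, entryOrZero_le_iff _ _ j.2,
    le_entryOrTop_iff _ _ j.2, rowsAt, Finset.mem_filter, Finset.mem_univ, content]
  omega

theorem mem_Icc_of_mem_rowsAt {S : SkewPartition} (T : S.Tableau n) {k c : ℕ} {r : Fin S.len}
    (hr : r ∈ rowsAt L T k c) : c - (L - r) ∈ Finset.Icc (S.inner r) (S.outer r) := by
  have hinner := inner_le_level T k r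
  have houter := level_le_outer T (k + 1) r
  have := (Finset.mem_filter.1 hr).2
  rw [Finset.mem_Icc]
  omega

theorem coinv_eq_pairCoinv (hL : ∀ p, (S p).len ≤ L) : coinv T = pairCoinv L (T 0) (T 1) := by
  classical
  rw [pairCoinv, ← Finset.card_sigma, coinv]
  symm
  refine Finset.card_bij (fun x hx => (⟨0, 1, x.1, ⟨x.2, ⟨_, mem_Icc_of_mem_rowsAt (T 1)
    (Finset.mem_sigma.1 hx).2⟩⟩⟩ : TripleData S)) ?_ ?_ ?_
  · rintro ⟨v, r⟩ hx
    have hr := (Finset.mem_sigma.1 hx).2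
    refine Finset.mem_filter.2 ⟨Finset.mem_univ _,
      (isTriple_and_isCoinversion_iff T hL _ _ _).2 ⟨?_, hr⟩⟩
    have := (Finset.mem_filter.1 hr).2
    simp only at this ⊢
    omega
  · rintro ⟨v, r⟩ hx ⟨v', r'⟩ hx' h
    simp only [Sigma.mk.injEq, heq_eq_eq, true_and] at h
    obtain ⟨rfl, rfl, -⟩ := h
    rfl
  · rintro ⟨p, q, v, r, j⟩ hx
    have hx' := (Finset.mem_filter.1 hx).2
    obtain ⟨rfl, rfl⟩ : p = 0 ∧ q = 1 := by
      have hpq : p < q := hx'.1.1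
      omega
    obtain ⟨hcol, hr⟩ := (isTriple_and_isCoinversion_iff T hL v r j).1 hx'
    refine ⟨⟨v, r⟩, Finset.mem_sigma.2 ⟨Finset.mem_univ _, hr⟩, ?_⟩
    simp only [← hcol, Nat.add_sub_cancel, Subtype.coe_eta]

end Coinv

/-- The boundary of the two-colored lattice given by two sequences of parts. -/
def pairState (L m : ℕ) {l₁ l₂ : ℕ} (p₁ : Fin l₁ → ℕ) (p₂ : Fin l₂ → ℕ) : Fin m → Bool × Bool :=
  fun c => (pathState L m p₁ c, pathState L m p₂ c)

/-- The chain of two-colored row boundaries of a pair of tableaux. -/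
def pairChain (L m : ℕ) (T : S₁.Tableau n × S₂.Tableau n) (k : Fin (n + 1)) : Fin m → Bool × Bool :=
  fun c => (tableauChain L m T.1 k c, tableauChain L m T.2 k c)

theorem pairChain_injective (hL₁ : S₁.len ≤ L) (hL₂ : S₂.len ≤ L) (hm₁ : ∀ i, S₁.outer i + L < m)
    (hm₂ : ∀ i, S₂.outer i + L < m) :
    Function.Injective (pairChain L m : S₁.Tableau n × S₂.Tableau n → _) := fun _ _ h =>
  Prod.ext
    (tableauChain_injective hL₁ hm₁ (funext₂ fun k c => congrArg Prod.fst (congrFun₂ h k c)))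
    (tableauChain_injective hL₂ hm₂ (funext₂ fun k c => congrArg Prod.snd (congrFun₂ h k c)))

theorem pairChain_zero (T : S₁.Tableau n × S₂.Tableau n) :
    pairChain L m T 0 = pairState L m S₁.inner S₂.inner := by
  funext c
  simp only [pairChain, pairState, tableauChain, Fin.val_zero, level_zero]

theorem pairChain_last (T : S₁.Tableau n × S₂.Tableau n) :
    pairChain L m T (Fin.last n) = pairState L m S₁.outer S₂.outer := by
  funext c
  simp only [pairChain, pairState, tableauChain, Fin.val_last, level_last]

section Weights

variable {R : Type*} [CommRing R]

theorem exists_pairChain_of_prod_ne_zero (t : R) (x : Fin n → R) (hL₁ : S₁.len ≤ L)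
    (hL₂ : S₂.len ≤ L) (hm₁ : ∀ i, S₁.outer i + L < m) (hm₂ : ∀ i, S₂.outer i + L < m)
    {g : Fin (n + 1) → Fin m → Bool × Bool} (hzero : g 0 = pairState L m S₁.inner S₂.inner)
    (hlast : g (Fin.last n) = pairState L m S₁.outer S₂.outer)
    (hg : ∏ k, rowMatrix t m (x k) (g k.castSucc) (g k.succ) ≠ 0) :
    ∃ T : S₁.Tableau n × S₂.Tableau n, pairChain L m T = g := by
  have hstrip (k : Fin n) : IsStrip (fun i => (g k.castSucc i).1) (fun i => (g k.succ i).1) false ∧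
      IsStrip (fun i => (g k.castSucc i).2) (fun i => (g k.succ i).2) false := by
    by_contra hk
    refine hg (Finset.prod_eq_zero (Finset.mem_univ k) ?_)
    rw [rowMatrix, rowWeight_eq, if_neg hk]
  have hblue : IsBoundaryChain S₁ L fun k i => (g k i).1 :=
    ⟨by simp only [hzero, pairState], by simp only [hlast, pairState], fun k => (hstrip k).1⟩
  have hred : IsBoundaryChain S₂ L fun k i => (g k i).2 :=
    ⟨by simp only [hzero, pairState], by simp only [hlast, pairState], fun k => (hstrip k).2⟩
  obtain ⟨T₁, hT₁⟩ := hblue.exists_tableau hL₁ hm₁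
  obtain ⟨T₂, hT₂⟩ := hred.exists_tableau hL₂ hm₂
  exact ⟨(T₁, T₂), funext₂ fun k c => Prod.ext (congrFun₂ hT₁ k c) (congrFun₂ hT₂ k c)⟩

theorem rowMatrix_pairChain (t : R) (x : Fin n → R) (hL₁ : S₁.len ≤ L) (hL₂ : S₂.len ≤ L)
    (hm₁ : ∀ i, S₁.outer i + L < m) (hm₂ : ∀ i, S₂.outer i + L < m)
    (T : S₁.Tableau n × S₂.Tableau n) (k : Fin n) :
    rowMatrix t m (x k) (pairChain L m T k.castSucc) (pairChain L m T k.succ) =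
      ∏ c : Fin m, (∏ v ∈ cellsAt L T.1 k (c + 1), x (T.1.1 v)) *
        (∏ v ∈ cellsAt L T.2 k (c + 1), x (T.2.1 v)) *
        ∏ v ∈ cellsAt L T.1 k (c + 1), t ^ (rowsAt L T.2 (T.1.1 v) (v.2 + (L - v.1) - 1)).card := by
  classical
  have hconst {S : SkewPartition} (T : S.Tableau n) (c : ℕ) :
      ∏ v ∈ cellsAt L T k c, x (T.1 v) = x k ^ (cellsAt L T k c).card :=
    Finset.prod_eq_pow_card fun v hv => by rw [(Finset.mem_filter.1 hv).2.1]
  rw [rowMatrix, rowWeight_eq, if_pos ⟨(tableauChain_isBoundaryChain hL₁ hm₁ T.1).2.2 k,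
    (tableauChain_isBoundaryChain hL₂ hm₂ T.2).2.2 k⟩]
  refine Finset.prod_congr rfl fun c _ => ?_
  simp only [pairChain]
  rw [edgeCount_tableauChain hL₁ hm₁, edgeCount_tableauChain hL₂ hm₂,
    countFrom_sub_countFrom_tableauChain hL₂ hm₂, pow_add, hconst, hconst,
    mul_comm (cellsAt ..).card, pow_mul]
  congr 1
  refine (Finset.prod_eq_pow_card fun v hv => ?_).symm
  obtain ⟨-, hletter, hcol⟩ := Finset.mem_filter.1 hv
  rw [hletter, hcol, Nat.add_sub_cancel]

theorem prod_rowMatrix_pairChain (t : R) (x : Fin n → R) (hL₁ : S₁.len ≤ L) (hL₂ : S₂.len ≤ L)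
    (hm₁ : ∀ i, S₁.outer i + L < m) (hm₂ : ∀ i, S₂.outer i + L < m)
    (T : S₁.Tableau n × S₂.Tableau n) :
    ∏ k : Fin n, rowMatrix t m (x k) (pairChain L m T k.castSucc) (pairChain L m T k.succ) =
      t ^ pairCoinv L T.1 T.2 * ((∏ v, x (T.1.1 v)) * ∏ v, x (T.2.1 v)) := by
  simp only [rowMatrix_pairChain t x hL₁ hL₂ hm₁ hm₂, Finset.prod_mul_distrib]
  rw [prod_cellsAt hm₁, prod_cellsAt hm₂, prod_cellsAt hm₁, Finset.prod_pow_eq_pow_sum, mul_comm,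
    pairCoinv]

end Weights

theorem coinvLLT_eq_partitionFunction (S : Fin 2 → SkewPartition) (n : ℕ)
    (hL : ∀ p, (S p).len ≤ L) (hm : ∀ p i, (S p).outer i + L < m) :
    coinvLLT S n =
      partitionFunction (MvPolynomial.C (LaurentPolynomial.T 1)) m MvPolynomial.X
        (pairState L m (S 0).inner (S 1).inner) (pairState L m (S 0).outer (S 1).outer) := by
  rw [partitionFunction, list_ofFn_prod_apply, coinvLLT]
  refine Finset.sum_of_injOn (fun T => pairChain L m (T 0, T 1)) ?_
    (fun _ _ => Finset.mem_coe.2 (Finset.mem_univ _)) ?_ ?_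
  · exact ((pairChain_injective (hL 0) (hL 1) (hm 0) (hm 1)).comp
      (piFinTwoEquiv fun p => (S p).Tableau n).injective).injOn
  · intro g _ hg
    refine ite_eq_right_iff.2 fun hb => by_contra fun hne => hg ?_
    obtain ⟨T, rfl⟩ :=
      exists_pairChain_of_prod_ne_zero _ _ (hL 0) (hL 1) (hm 0) (hm 1) hb.1 hb.2 hne
    obtain ⟨T, rfl⟩ := (piFinTwoEquiv fun p => (S p).Tableau n).surjective T
    exact ⟨T, Finset.mem_coe.2 (Finset.mem_univ _), rfl⟩
  · intro T _
    rw [if_pos ⟨pairChain_zero _, pairChain_last _⟩,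
      prod_rowMatrix_pairChain _ _ (hL 0) (hL 1) (hm 0) (hm 1), Fin.prod_univ_two,
      coinv_eq_pairCoinv T hL, ← map_pow, LaurentPolynomial.T_pow, mul_one]

end LatticeLLT

section UniqueMatching

open Finset

variable {α ι R : Type*} [LinearOrder ι] {pos : α → ι} {s P : Finset α}
  {M : Finset (Sym2 α)}

theorem card_filter_lt_eq_add_card_between (hpos : Set.InjOn pos s) {x y : α} (hy : y ∈ s)
    (hxy : pos x < pos y) : #{j ∈ s | pos x < pos j} =
      #{j ∈ s | pos y < pos j} + 1 + #{j ∈ s | pos x < pos j ∧ pos j < pos y} := by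
  classical
  have hsplit : {j ∈ s | pos x < pos j} = insert y {j ∈ s | pos y < pos j} ∪
      {j ∈ s | pos x < pos j ∧ pos j < pos y} := by
    ext j
    simp only [mem_filter, mem_union, mem_insert]
    refine ⟨fun ⟨hj, hxj⟩ => ?_, ?_⟩
    · rcases lt_trichotomy (pos j) (pos y) with h | h | h
      exacts [Or.inr ⟨hj, hxj, h⟩, Or.inl (Or.inl (hpos hj hy h)), Or.inl (Or.inr ⟨hj, h⟩)]
    · rintro ((rfl | ⟨hj, h⟩) | ⟨hj, h, -⟩)
      exacts [⟨hy, hxy⟩, ⟨hj, hxy.trans h⟩, ⟨hj, h⟩]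
  rw [hsplit, card_union_of_disjoint, card_insert_of_notMem (by simp)]
  simp only [disjoint_left, mem_insert, mem_filter]
  rintro j (rfl | ⟨-, h⟩) ⟨-, -, h'⟩
  exacts [h'.false, h.asymm h']

theorem zpow_finset_sum {G : Type*} [CommGroup G] (q : G) (s : Finset α) (f : α → ℤ) :
    q ^ ∑ i ∈ s, f i = ∏ i ∈ s, q ^ f i := by
  classical
  induction s using Finset.induction_on with
  | empty => simp
  | insert i s hi ih => rw [sum_insert hi, prod_insert hi, zpow_add, ih]

namespace IsNCMatching

theorem pos_ne (hM : IsNCMatching pos s P M) (hpos : Set.InjOn pos s) {x y : α}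
    (hxy : s(x, y) ∈ M) : pos x ≠ pos y := fun h => by
  have := hM.opposite x y hxy
  rw [hpos (hM.left_mem hxy) (hM.right_mem hxy) h] at this
  tauto

theorem even_arcShift (hM : IsNCMatching pos s P M) (hpos : Set.InjOn pos s) {x y : α}
    (hxy : s(x, y) ∈ M) : Even (arcShift pos s x y) := by
  rw [arcShift]
  rcases (hM.pos_ne hpos hxy).lt_or_gt with h | h
  · obtain ⟨k, hk⟩ := hM.even_card_between hpos hxy
    rw [card_filter_lt_eq_add_card_between hpos (hM.right_mem hxy) h, hk, if_pos h]
    exact ⟨k, by push_cast; ring⟩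
  · obtain ⟨k, hk⟩ := hM.even_card_between hpos (Sym2.eq_swap ▸ hxy)
    rw [card_filter_lt_eq_add_card_between hpos (hM.left_mem hxy) h, hk, if_neg h.not_gt]
    exact ⟨-k, by push_cast; ring⟩

theorem neg_one_pow_above [Monoid R] [HasDistribNeg R] (hM : IsNCMatching pos s P M)
    (hpos : Set.InjOn pos s) {x y : α} (hxy : s(x, y) ∈ M) :
    (-1 : R) ^ #{j ∈ s | pos y < pos j} = -(-1) ^ #{j ∈ s | pos x < pos j} := by
  have heven := hM.even_arcShift hpos hxy
  rw [arcShift] at heven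
  have hparity : Even #{j ∈ s | pos y < pos j} ↔ ¬ Even #{j ∈ s | pos x < pos j} := by
    split_ifs at heven <;> grind
  rcases Nat.even_or_odd #{j ∈ s | pos x < pos j} with h | h
  · rw [h.neg_one_pow, (Nat.not_even_iff_odd.1 (mt hparity.1 (not_not.2 h))).neg_one_pow]
  · rw [h.neg_one_pow, (hparity.2 (Nat.not_even_iff_odd.2 h)).neg_one_pow, neg_neg]

theorem sum_eq_sum_partner {A : Type*} [AddCommMonoid A] (hM : IsNCMatching pos s P M)
    (hP : P ⊆ s) {π : α → α} (hπ : ∀ b ∈ s, ∀ c, s(b, c) ∈ M ↔ π b = c) (f : Sym2 α → A) :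
    ∑ e ∈ M, f e = ∑ p ∈ P, f s(p, π p) := by
  have harc : ∀ p ∈ P, s(p, π p) ∈ M := fun p hp => (hπ p (hP hp) _).2 rfl
  symm
  refine sum_nbij (fun p => s(p, π p)) harc ?_ ?_ fun _ _ => rfl
  · intro p hp p' hp' h
    rcases Sym2.eq_iff.1 h with ⟨h, -⟩ | ⟨h, -⟩
    · exact h
    · exact absurd (h ▸ hp) ((hM.opposite _ _ (harc p' hp')).1 hp')
  · intro e he
    obtain ⟨b, c, hbc, hb⟩ : ∃ b c, e = s(b, c) ∧ b ∈ P := by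
      induction e using Sym2.ind with
      | _ b c =>
      by_cases hb : b ∈ P
      · exact ⟨b, c, rfl, hb⟩
      · exact ⟨c, b, Sym2.eq_swap, by simpa [hb] using hM.opposite b c he⟩
    subst hbc
    exact ⟨b, hb, congrArg (s(b, ·)) ((hπ b (hP hb) c).1 he)⟩

variable [DecidableEq α]

theorem bijOn_partner (hM : IsNCMatching pos s P M) (hP : P ⊆ s) {π : α → α}
    (hπ : ∀ b ∈ s, ∀ c, s(b, c) ∈ M ↔ π b = c) : Set.BijOn π P ↑(s \ P) := by
  have harc : ∀ b ∈ s, s(b, π b) ∈ M := fun b hb => (hπ b hb _).2 rfl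
  have hππ : ∀ b ∈ s, π (π b) = b := fun b => hM.partner_partner hπ
  refine ⟨fun p hp => ?_, fun p hp p' hp' h => ?_, fun c hc => ?_⟩
  · exact mem_coe.2 (mem_sdiff.2 ⟨hM.right_mem (harc p (hP hp)),
      (hM.opposite _ _ (harc p (hP hp))).1 hp⟩)
  · rw [← hππ p (hP hp), h, hππ p' (hP hp')]
  · obtain ⟨hcs, hcP⟩ := mem_sdiff.1 (mem_coe.1 hc)
    exact ⟨π c, by simpa [hcP] using hM.opposite c _ (harc c hcs), hππ c hcs⟩

theorem prod_sdiff_eq {G : Type*} [CommGroup G] [HasDistribNeg G] {q : G} {f : α → ℤ}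
    (hM : IsNCMatching pos s P M) (hP : P ⊆ s) (hpos : Set.InjOn pos s) {π : α → α}
    (hπ : ∀ b ∈ s, ∀ c, s(b, c) ∈ M ↔ π b = c) :
    ∏ c ∈ s \ P, ((-1) ^ #{j ∈ s | pos c < pos j} * q ^ (-f c)) =
      (-1) ^ #P * q ^ (∑ p ∈ P, (f p - f (π p))) *
        ∏ p ∈ P, ((-1) ^ #{j ∈ s | pos p < pos j} * q ^ (-f p)) := by
  have hbij := hM.bijOn_partner hP hπ
  rw [← prod_const, zpow_finset_sum, ← prod_mul_distrib, ← prod_mul_distrib]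
  refine (prod_nbij π hbij.mapsTo hbij.injOn hbij.surjOn fun p hp => ?_).symm
  rw [hM.neg_one_pow_above hpos ((hπ p (hP hp) _).2 rfl),
    show -f (π p) = f p - f (π p) + -f p by ring, zpow_add]
  simp only [neg_mul, one_mul, mul_neg, mul_left_comm]

theorem even_of_eq_arcShift (hM : IsNCMatching pos s P M) (hpos : Set.InjOn pos s)
    {f : α → ℤ} {w : Sym2 α → ℤ}
    (hw : ∀ p ∈ P, ∀ c ∈ s \ P, w s(p, c) = 2 * (f p - f c) + arcShift pos s p c) {e : Sym2 α}
    (he : e ∈ M) : Even (w e) := by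
  have hsource {b c : α} (hbc : s(b, c) ∈ M) (hb : b ∈ P) : Even (w s(b, c)) := by
    rw [hw b hb c (mem_sdiff.2 ⟨hM.right_mem hbc, (hM.opposite b c hbc).1 hb⟩)]
    exact (even_two_mul _).add (hM.even_arcShift hpos hbc)
  induction e using Sym2.ind with
  | _ b c =>
  by_cases hb : b ∈ P
  · exact hsource he hb
  · rw [Sym2.eq_swap] at he ⊢
    exact hsource he ((hM.opposite c b he).2 hb)

end IsNCMatching

variable [DecidableEq α]

theorem LoweringRelation.eq_zpow_mul_of_unique [CommRing R] [IsDomain R] {q : Rˣ}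
    {Z : Finset α → R} {f : α → ℤ}
    (hZ : LoweringRelation (q : R) pos s #P fun Q =>
      ↑(∏ b ∈ Q, ((-1) ^ #{j ∈ s | pos b < pos j} * q ^ (-f b))) * Z Q)
    (hq : ∀ k, ∑ m ∈ range (k + 1), (q : R) ^ m ≠ 0) (hP : P ⊆ s) (hpos : Set.InjOn pos s)
    (hM : IsNCMatching pos s P M) (hunique : ∀ M', IsNCMatching pos s P M' → M' = M)
    {w : Sym2 α → ℤ}
    (hw : ∀ p ∈ P, ∀ c ∈ s \ P, w s(p, c) = 2 * (f p - f c) + arcShift pos s p c) :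
    Z P = ↑(q ^ ∑ a ∈ M, w a / 2) * Z (s \ P) := by
  obtain ⟨π, hπ⟩ := hM.exists_partner
  have hbij := hM.bijOn_partner hP hπ
  have harc : ∀ p ∈ P, s(p, π p) ∈ M := fun p hp => (hπ p (hP hp) _).2 rfl
  have hN : #(s \ P) = #P := (card_nbij π hbij.mapsTo hbij.injOn hbij.surjOn).symm
  have halt : ¬ HasAlternation pos s P := not_hasAlternation_of_unique hM hunique hpos (by
    rw [filter_mem_eq_inter, inter_eq_right.2 hP, filter_notMem_eq_sdiff, hN])
  have hshift : ∀ p ∈ P, w s(p, π p) / 2 = f p - f (π p) + arcShift pos s p (π p) / 2 :=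
    fun p hp => by
      rw [hw p hp _ (hbij.mapsTo hp), Int.add_ediv_of_dvd_left (dvd_mul_right _ _),
        Int.mul_ediv_cancel_left _ two_ne_zero]
  have hflip := hZ.apply_eq_zpow_mul hq hP rfl hN hpos halt hbij
    (e := ∑ p ∈ P, arcShift pos s p (π p) / 2) (by
      rw [mul_sum]
      exact sum_congr rfl fun p hp =>
        (Int.mul_ediv_cancel' (hM.even_arcShift hpos (harc p hp)).two_dvd).symm)
  rw [hM.prod_sdiff_eq hP hpos hπ] at hflip
  rw [hM.sum_eq_sum_partner hP hπ, sum_congr rfl hshift, sum_add_distrib, zpow_add]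
  refine (Units.mul_right_inj
    (∏ p ∈ P, ((-1) ^ #{j ∈ s | pos p < pos j} * q ^ (-f p)))).1 (hflip.trans ?_)
  have hsign : ((-1 : R) ^ #P) * (-1) ^ #P = 1 := by rw [← mul_pow]; simp
  simp only [Units.val_mul, Units.val_pow_eq_pow_val, Units.val_neg, Units.val_one]
  linear_combination (↑(q ^ ∑ p ∈ P, arcShift pos s p (π p) / 2) * ↑(q ^ ∑ p ∈ P, (f p - f (π p))) *
    ↑(∏ p ∈ P, ((-1) ^ #{j ∈ s | pos p < pos j} * q ^ (-f p))) * Z (s \ P)) * hsign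

end UniqueMatching

namespace Bead

open Finset

variable {S₁ S₂ : SkewPartition}

/-- The finite set of beads of a pair of skew partitions. -/
def beadSet (S₁ S₂ : SkewPartition) : Finset Bead :=
  ((pathCols S₁ .top \ pathCols S₂ .top).image (Bead.mk .top .blue) ∪
    (pathCols S₂ .top \ pathCols S₁ .top).image (Bead.mk .top .red)) ∪
  ((pathCols S₁ .bottom \ pathCols S₂ .bottom).image (Bead.mk .bottom .blue) ∪
    (pathCols S₂ .bottom \ pathCols S₁ .bottom).image (Bead.mk .bottom .red))

theorem mem_beadSet {b : Bead} : b ∈ beadSet S₁ S₂ ↔ IsBead S₁ S₂ b := by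
  obtain ⟨row, color, col⟩ := b
  cases row <;> cases color <;> simp [beadSet, IsBead]

theorem eq_of_row_eq_of_col_eq {b c : Bead} (hb : b ∈ beadSet S₁ S₂) (hc : c ∈ beadSet S₁ S₂)
    (hrow : b.row = c.row) (hcol : b.col = c.col) : b = c := by
  rw [mem_beadSet] at hb hc
  obtain ⟨r, k, x⟩ := b
  obtain ⟨r', k', x'⟩ := c
  obtain rfl : r = r' := hrow
  obtain rfl : x = x' := hcol
  cases k <;> cases k' <;> simp only [IsBead] at hb hc <;> first | rfl | tauto

/-- The position of a bead on the boundary of the strip: first the bottom row from left to right,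
then the top row from right to left, which is the reverse of the order `Before`. -/
def pos (b : Bead) : ℤ ⊕ₗ ℤᵒᵈ :=
  match b.row with
  | .bottom => toLex (Sum.inl b.col)
  | .top => toLex (Sum.inr (OrderDual.toDual b.col))

theorem before_iff {b c : Bead} : Before b c ↔ pos c < pos b := by
  obtain ⟨r, k, x⟩ := b
  obtain ⟨r', k', x'⟩ := c
  cases r <;> cases r' <;> simp [pos, Before]

theorem injOn_pos : Set.InjOn pos (beadSet S₁ S₂ : Set Bead) := by
  intro b hb c hc h
  have hrowcol : b.row = c.row ∧ b.col = c.col := by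
    obtain ⟨r, k, x⟩ := b
    obtain ⟨r', k', x'⟩ := c
    cases r <;> cases r' <;> simp_all [pos]
  exact eq_of_row_eq_of_col_eq hb hc hrowcol.1 hrowcol.2

/-- The beads at which a path enters the strip between the two rows, if blue paths are oriented
upwards and red paths downwards: the blue beads of the bottom row and the red beads of the top
row. -/
def sources (S₁ S₂ : SkewPartition) : Finset Bead :=
  {b ∈ beadSet S₁ S₂ | b.color = .blue ↔ b.row = .bottom}

theorem sources_subset : sources S₁ S₂ ⊆ beadSet S₁ S₂ := filter_subset _ _

theorem arcAllowed_iff {b c : Bead} (hb : b ∈ beadSet S₁ S₂) (hc : c ∈ beadSet S₁ S₂) :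
    ArcAllowed b c ↔ (b ∈ sources S₁ S₂ ↔ c ∉ sources S₁ S₂) := by
  simp only [sources, mem_filter, hb, hc, true_and, ArcAllowed]
  obtain ⟨r, k, x⟩ := b
  obtain ⟨r', k', x'⟩ := c
  cases r <;> cases k <;> cases r' <;> cases k' <;> simp

theorem isNCMatching_iff (M : Finset (Sym2 Bead)) :
    IsNCMatching pos (beadSet S₁ S₂) (sources S₁ S₂) M ↔
      IsMatching S₁ S₂ M ∧ IsNonCrossing M := by
  have hcross : IsNonCrossing M ↔ ∀ b₁ b₂ c₁ c₂, s(b₁, c₁) ∈ M → s(b₂, c₂) ∈ M →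
      ¬ (pos b₁ < pos b₂ ∧ pos b₂ < pos c₁ ∧ pos c₁ < pos c₂) := by
    simp only [IsNonCrossing, before_iff]
    constructor <;> intro h b₁ b₂ c₁ c₂ h₁ h₂ ⟨hb, hbc, hc⟩ <;>
      exact h c₂ c₁ b₂ b₁ (Sym2.eq_swap ▸ h₂) (Sym2.eq_swap ▸ h₁) ⟨hc, hbc, hb⟩
  have hallowed (hmem : ∀ a ∈ M, ∀ b ∈ a, b ∈ beadSet S₁ S₂) {b c : Bead} (h : s(b, c) ∈ M) :
      ArcAllowed b c ↔ (b ∈ sources S₁ S₂ ↔ c ∉ sources S₁ S₂) :=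
    arcAllowed_iff (hmem _ h b (Sym2.mem_mk_left b c)) (hmem _ h c (Sym2.mem_mk_right b c))
  constructor
  · intro h
    exact ⟨⟨fun a ha b hb => mem_beadSet.1 (h.mem a ha b hb),
      fun b c hbc => (hallowed h.mem hbc).2 (h.opposite b c hbc),
      fun b hb => h.covers b (mem_beadSet.2 hb)⟩, hcross.2 h.noncrossing⟩
  · rintro ⟨h, hnc⟩
    have hmem : ∀ a ∈ M, ∀ b ∈ a, b ∈ beadSet S₁ S₂ :=
      fun a ha b hb => mem_beadSet.2 (h.isBead a ha b hb)
    exact ⟨hmem, fun b c hbc => (hallowed hmem hbc).1 (h.allowed b c hbc),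
      fun b hb => h.covers b (mem_beadSet.1 hb), hcross.1 hnc⟩

section Labels

/-- The number of beads to the right of a bead in its row. -/
def beadsRight (S₁ S₂ : SkewPartition) (b : Bead) : ℕ :=
  #{j ∈ beadSet S₁ S₂ | j.row = b.row ∧ b.col < j.col}

/-- The number of columns with two paths to the right of a bead in its row. -/
def doublesRight (S₁ S₂ : SkewPartition) (b : Bead) : ℕ :=
  #{x ∈ pathCols S₁ b.row ∩ pathCols S₂ b.row | b.col < x}

theorem label_eq (S₁ S₂ : SkewPartition) (b : Bead) :
    label S₁ S₂ b = beadsRight S₁ S₂ b + 2 * doublesRight S₁ S₂ b := by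
  set A := {x ∈ pathCols S₁ b.row | b.col < x} with hA
  set C := {x ∈ pathCols S₂ b.row | b.col < x} with hC
  have hdoubles : doublesRight S₁ S₂ b = #(A ∩ C) := by
    rw [doublesRight, hA, hC, ← filter_inter_distrib]
  have hbeads : beadsRight S₁ S₂ b = #(A \ C) + #(C \ A) := by
    rw [beadsRight, ← card_image_of_injective (A \ C) (f := Bead.mk b.row .blue)
      fun _ _ h => congrArg col h, ← card_image_of_injective (C \ A) (f := Bead.mk b.row .red)
      fun _ _ h => congrArg col h,
      ← card_union_of_disjoint (by simp only [disjoint_left, mem_image]; grind)]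
    congr 1
    ext ⟨r, k, x⟩
    cases k <;> simp only [mem_filter, mem_beadSet, IsBead, hA, hC, mem_union, mem_image,
      mem_sdiff, mk.injEq] <;> grind
  have hcardA := card_sdiff_add_card_inter A C
  have hcardC := card_sdiff_add_card_inter C A
  rw [inter_comm C A] at hcardC
  rw [show label S₁ S₂ b = (#A : ℤ) + #C from rfl, hdoubles, hbeads]
  lia

/-- The part of the exponent of `t` in the flip coefficient of a bead which depends only on that
bead, once the exponent is taken relative to the order `pos`. -/
def flipExponent (S₁ S₂ : SkewPartition) (b : Bead) : ℕ :=
  doublesRight S₁ S₂ b + if b.row = .top then beadsRight S₁ S₂ b else 0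

theorem card_above_of_bottom {b : Bead} (hrow : b.row = .bottom) :
    #{j ∈ beadSet S₁ S₂ | pos b < pos j} =
      beadsRight S₁ S₂ b + #{j ∈ beadSet S₁ S₂ | j.row = .top} := by
  simp only [beadsRight, card_filter, ← sum_add_distrib]
  refine sum_congr rfl fun ⟨r, k, x⟩ _ => ?_
  obtain ⟨r', k', x'⟩ := b
  obtain rfl : r' = .bottom := hrow
  cases r <;> simp [pos]

theorem card_above_of_top {b : Bead} (hb : b ∈ beadSet S₁ S₂) (hrow : b.row = .top) :
    #{j ∈ beadSet S₁ S₂ | pos b < pos j} + beadsRight S₁ S₂ b + 1 =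
      #{j ∈ beadSet S₁ S₂ | j.row = .top} := by
  have hone : 1 = #{j ∈ beadSet S₁ S₂ | j = b} := by rw [filter_eq', if_pos hb, card_singleton]
  conv_lhs => rw [hone]
  clear hone
  simp only [beadsRight, card_filter, ← sum_add_distrib]
  refine sum_congr rfl fun j hj => ?_
  have heq : j = b ↔ j.row = b.row ∧ j.col = b.col :=
    ⟨fun h => h ▸ ⟨rfl, rfl⟩, fun h => eq_of_row_eq_of_col_eq hj hb h.1 h.2⟩
  obtain ⟨r, k, x⟩ := j
  obtain ⟨r', k', x'⟩ := b
  obtain rfl : r' = .top := hrow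
  simp only [heq]
  cases r
  · rcases lt_trichotomy x x' with h | rfl | h
    · simp [pos, h, h.not_gt, h.ne]
    · simp [pos]
    · simp [pos, h, h.not_gt, h.ne']
  · simp [pos]

theorem label_sub_eq {b : Bead} (hb : b ∈ beadSet S₁ S₂) :
    label S₁ S₂ b - (if b.row = .top then 1 else 0) =
      2 * flipExponent S₁ S₂ b + #{j ∈ beadSet S₁ S₂ | pos b < pos j} -
        #{j ∈ beadSet S₁ S₂ | j.row = .top} := by
  rw [label_eq, flipExponent]
  cases hrow : b.row
  · have habove := card_above_of_top hb hrow
    simp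
    lia
  · have habove := card_above_of_bottom (S₁ := S₁) (S₂ := S₂) hrow
    simp
    lia

theorem neg_one_pow_beadsRight {R : Type*} [CommRing R] {b : Bead} (hb : b ∈ beadSet S₁ S₂) :
    (if b.row = .bottom then 1 else -1) * (-1 : R) ^ beadsRight S₁ S₂ b =
      (-1) ^ #{j ∈ beadSet S₁ S₂ | j.row = .top} * (-1) ^ #{j ∈ beadSet S₁ S₂ | pos b < pos j} := by
  have hsquare (k : ℕ) : (-1 : R) ^ k * (-1) ^ k = 1 := by
    rw [← pow_add, (Even.add_self k).neg_one_pow]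
  cases hrow : b.row
  · rw [← card_above_of_top hb hrow, pow_succ, pow_add, if_neg BeadRow.noConfusion]
    linear_combination (-1) ^ beadsRight S₁ S₂ b * hsquare (#{j ∈ beadSet S₁ S₂ | pos b < pos j})
  · rw [card_above_of_bottom hrow, pow_add, if_pos rfl]
    linear_combination -(-1) ^ beadsRight S₁ S₂ b * hsquare (#{j ∈ beadSet S₁ S₂ | j.row = .top})

theorem twiceArcExponent_eq_label {p c : Bead} (hp : p ∈ sources S₁ S₂)
    (hc : c ∈ beadSet S₁ S₂ \ sources S₁ S₂) :
    twiceArcExponent S₁ S₂ s(p, c) =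
      (label S₁ S₂ p - if p.row = .top then 1 else 0) -
        (label S₁ S₂ c - if c.row = .top then 1 else 0) + if pos p < pos c then -1 else 1 := by
  obtain ⟨hcs, hcP⟩ := mem_sdiff.1 hc
  have hcol (hrow : p.row = c.row) : p.col ≠ c.col := fun hcol =>
    hcP (eq_of_row_eq_of_col_eq (sources_subset hp) hcs hrow hcol ▸ hp)
  replace hp := (mem_filter.1 hp).2
  replace hcP : ¬ (c.color = .blue ↔ c.row = .bottom) := fun h => hcP (mem_filter.2 ⟨hcs, h⟩)
  change arcTable S₁ S₂ p c + arcTable S₁ S₂ c p = _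
  simp only [arcTable]
  generalize label S₁ S₂ p = i
  generalize label S₁ S₂ c = j
  clear hc hcs
  obtain ⟨r, k, x⟩ := p
  obtain ⟨r', k', x'⟩ := c
  cases r <;> cases k <;> simp at hp <;> cases r' <;> cases k' <;> simp at hcP <;>
    simp [pos] at hcol ⊢ <;> grind

theorem twiceArcExponent_eq {p c : Bead} (hp : p ∈ sources S₁ S₂)
    (hc : c ∈ beadSet S₁ S₂ \ sources S₁ S₂) :
    twiceArcExponent S₁ S₂ s(p, c) =
      2 * ((flipExponent S₁ S₂ p : ℤ) - flipExponent S₁ S₂ c) +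
        arcShift pos (beadSet S₁ S₂) p c := by
  rw [twiceArcExponent_eq_label hp hc, label_sub_eq (sources_subset hp),
    label_sub_eq (mem_sdiff.1 hc).1, arcShift]
  ring

end Labels

section Coloring

variable {L m : ℕ} {row : BeadRow} {Q : Finset Bead} {i c : Fin m}

/-- All columns of paths, shifted by `L`, lie in the window `0, …, m - 1`. -/
structure IsWindow (S₁ S₂ : SkewPartition) (L m : ℕ) : Prop where
  len₁ : S₁.len ≤ L
  len₂ : S₂.len ≤ L
  outer₁ : ∀ i, S₁.outer i + L < m
  outer₂ : ∀ i, S₂.outer i + L < m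

theorem exists_isWindow (S₁ S₂ : SkewPartition) : ∃ L m, IsWindow S₁ S₂ L m := by
  refine ⟨S₁.len + S₂.len, ∑ i, S₁.outer i + ∑ i, S₂.outer i + (S₁.len + S₂.len) + 1,
    by lia, by lia, fun i => ?_, fun i => ?_⟩
  · have := single_le_sum (f := S₁.outer) (fun _ _ => Nat.zero_le _) (mem_univ i)
    lia
  · have := single_le_sum (f := S₂.outer) (fun _ _ => Nat.zero_le _) (mem_univ i)
    lia

theorem exists_window_col {S : SkewPartition} (hL : S.len ≤ L) (hm : ∀ i, S.outer i + L < m)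
    {x : ℤ} (hx : x ∈ pathCols S row) : ∃ c : Fin m, (c : ℤ) - L = x := by
  have hbounds : 0 ≤ x + L ∧ x + L < m := by
    cases row <;> simp only [pathCols, mem_image, mem_univ, true_and] at hx <;>
      obtain ⟨i, rfl⟩ := hx <;> grind [hm i, S.inner_le_outer i]
  exact ⟨⟨(x + L).toNat, by lia⟩, by simp [hbounds.1]⟩

/-- The occupied columns of a boundary, in the window. -/
def occupied (S : SkewPartition) (L : ℕ) {m : ℕ} (row : BeadRow) (c : Fin m) : Bool :=
  decide ((c : ℤ) - L ∈ pathCols S row)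

theorem pathState_inner {S : SkewPartition} (hL : S.len ≤ L) :
    pathState L m S.inner = occupied S L .bottom := by
  funext c
  simp only [pathState, occupied, pathCols, mem_image, mem_univ, true_and, decide_eq_decide]
  exact exists_congr fun i => by lia

theorem pathState_outer {S : SkewPartition} (hL : S.len ≤ L) :
    pathState L m S.outer = occupied S L .top := by
  funext c
  simp only [pathState, occupied, pathCols, mem_image, mem_univ, true_and, decide_eq_decide]
  exact exists_congr fun i => by lia

/-- The path end in the column `c` of the window, which is red if there is no blue one. -/
def beadAt (S₁ : SkewPartition) (L : ℕ) {m : ℕ} (row : BeadRow) (c : Fin m) : Bead :=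
  ⟨row, if (c : ℤ) - L ∈ pathCols S₁ row then .blue else .red, (c : ℤ) - L⟩

theorem beadAt_injective (row : BeadRow) :
    Function.Injective (beadAt S₁ L row : Fin m → Bead) := fun c c' h => by
  have : (c : ℤ) - L = c' - L := congrArg Bead.col h
  exact Fin.ext (by lia)

theorem beadAt_mem_iff :
    beadAt S₁ L row c ∈ beadSet S₁ S₂ ↔ occupied S₁ L row c ≠ occupied S₂ L row c := by
  rw [mem_beadSet, beadAt, occupied, occupied]
  by_cases h : (c : ℤ) - L ∈ pathCols S₁ row <;> by_cases h' : (c : ℤ) - L ∈ pathCols S₂ row <;>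
    simp [IsBead, h, h']

theorem IsWindow.exists_beadAt (hw : IsWindow S₁ S₂ L m) {b : Bead} (hb : b ∈ beadSet S₁ S₂) :
    ∃ c : Fin m, beadAt S₁ L b.row c = b := by
  rw [mem_beadSet] at hb
  obtain ⟨r, k, x⟩ := b
  cases k
  · obtain ⟨c, hc⟩ := exists_window_col hw.len₁ hw.outer₁ hb.1
    exact ⟨c, by simp_all [beadAt, IsBead]⟩
  · obtain ⟨c, hc⟩ := exists_window_col hw.len₂ hw.outer₂ hb.1
    exact ⟨c, by simp_all [beadAt, IsBead]⟩

theorem IsWindow.image_beadAt (hw : IsWindow S₁ S₂ L m) (hQ : Q ⊆ beadSet S₁ S₂) (row : BeadRow) :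
    (univ.filter fun c : Fin m => beadAt S₁ L row c ∈ Q).image (beadAt S₁ L row) =
      {b ∈ Q | b.row = row} := by
  ext b
  simp only [mem_image, mem_filter, mem_univ, true_and]
  constructor
  · rintro ⟨c, hc, rfl⟩
    exact ⟨hc, rfl⟩
  · rintro ⟨hb, rfl⟩
    obtain ⟨c, hc⟩ := hw.exists_beadAt (hQ hb)
    exact ⟨c, by rwa [hc], hc⟩

theorem IsWindow.card_filter_beadAt_mem (hw : IsWindow S₁ S₂ L m) (hQ : Q ⊆ beadSet S₁ S₂)
    (row : BeadRow) (i : Fin m) : #{j ∈ Ioi i | beadAt S₁ L row j ∈ Q} =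
      #{b ∈ Q | b.row = row ∧ (beadAt S₁ L row i).col < b.col} := by
  rw [← card_image_of_injective _ (beadAt_injective row), ← filter_filter, ← hw.image_beadAt hQ,
    filter_image, filter_filter]
  congr 2
  ext j
  simp only [mem_filter, mem_univ, mem_Ioi, true_and]
  simp [beadAt, and_comm]

theorem IsWindow.card_filter_double (hw : IsWindow S₁ S₂ L m) (row : BeadRow) (i : Fin m) :
    #{j ∈ Ioi i | beadAt S₁ L row j ∉ beadSet S₁ S₂ ∧ occupied S₂ L row j = true} =
      doublesRight S₁ S₂ (beadAt S₁ L row i) := by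
  have hinj : Function.Injective fun j : Fin m => (j : ℤ) - L := fun j j' h =>
    Fin.ext (by simpa using h)
  rw [doublesRight, ← card_image_of_injective _ hinj]
  congr 1
  ext x
  simp only [mem_image, mem_filter, mem_Ioi, beadAt_mem_iff, not_not, mem_inter]
  constructor
  · rintro ⟨j, ⟨hij, hj₁, hj₂⟩, rfl⟩
    rw [hj₂] at hj₁
    exact ⟨⟨by simpa [occupied, beadAt] using hj₁, by simpa [occupied, beadAt] using hj₂⟩,
      by simpa [beadAt]⟩
  · rintro ⟨⟨hx₁, hx₂⟩, hlt⟩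
    obtain ⟨j, rfl⟩ := exists_window_col hw.len₁ hw.outer₁ hx₁
    refine ⟨j, ⟨by simpa [beadAt] using hlt, ?_⟩, rfl⟩
    simp_all [occupied, beadAt]

/-- The occupation numbers of a column with a bead at which a path enters the strip: a blue path in
the bottom row, a red path in the top row. -/
def sourceState : BeadRow → Bool × Bool
  | .bottom => (true, false)
  | .top => (false, true)

/-- The occupation numbers of a boundary after recoloring its beads in such a way that the paths
enter the strip at the beads of `Q`. -/
def rowState (S₁ S₂ : SkewPartition) (L : ℕ) {m : ℕ} (row : BeadRow) (Q : Finset Bead) (c : Fin m) :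
    Bool × Bool :=
  if beadAt S₁ L row c ∈ beadSet S₁ S₂ then
    if beadAt S₁ L row c ∈ Q then sourceState row else (sourceState row).swap
  else (occupied S₁ L row c, occupied S₂ L row c)

theorem rowState_eq_sourceState_iff (hQ : Q ⊆ beadSet S₁ S₂) :
    rowState S₁ S₂ L row Q c = sourceState row ↔ beadAt S₁ L row c ∈ Q := by
  by_cases hs : beadAt S₁ L row c ∈ beadSet S₁ S₂
  · by_cases hc : beadAt S₁ L row c ∈ Q <;> cases row <;> simp [rowState, sourceState, hs, hc]
  · have hc := mt (@hQ _) hs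
    rw [rowState, if_neg hs]
    rw [beadAt_mem_iff, not_not] at hs
    rw [hs]
    cases row <;> simp [sourceState, hc]

theorem rowState_erase (hi : beadAt S₁ L row i ∈ beadSet S₁ S₂) :
    rowState S₁ S₂ L row (Q.erase (beadAt S₁ L row i)) =
      Function.update (rowState S₁ S₂ L row Q) i (sourceState row).swap := by
  funext c
  rcases eq_or_ne c i with rfl | hc
  · simp [rowState, hi]
  · simp [rowState, hc, (beadAt_injective row).eq_iff]

theorem rowState_erase_of_ne {b : Bead} (h : b.row ≠ row) :
    (rowState S₁ S₂ L row (Q.erase b) : Fin m → Bool × Bool) = rowState S₁ S₂ L row Q := by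
  funext c
  have hne : beadAt S₁ L row c ≠ b := fun e => h (congrArg Bead.row e).symm
  simp [rowState, mem_erase, hne]

theorem rowState_sources : (rowState S₁ S₂ L row (sources S₁ S₂) : Fin m → Bool × Bool) =
    fun c => (occupied S₁ L row c, occupied S₂ L row c) := by
  funext c
  by_cases hs : beadAt S₁ L row c ∈ beadSet S₁ S₂
  · have hne := beadAt_mem_iff.1 hs
    rw [rowState, if_pos hs]
    simp only [sources, mem_filter, hs, true_and]
    by_cases h : (c : ℤ) - L ∈ pathCols S₁ row <;> cases row <;>
      simp_all [beadAt, occupied, sourceState]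
  · rw [rowState, if_neg hs]

theorem rowState_sdiff :
    rowState S₁ S₂ L row (beadSet S₁ S₂ \ Q) c = (rowState S₁ S₂ L row Q c).swap := by
  by_cases hs : beadAt S₁ L row c ∈ beadSet S₁ S₂
  · by_cases hc : beadAt S₁ L row c ∈ Q <;> simp [rowState, hs, hc]
  · have hs' := hs
    rw [beadAt_mem_iff, not_not] at hs'
    simp [rowState, hs, hs']

end Coloring

section Relation

variable {R : Type*} [CommRing R] {L m n : ℕ} {Q : Finset Bead}

/-- The number of red paths to the right of a bead in its row, after recoloring the beads in such a
way that the paths enter the strip at the beads of `Q`. -/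
def redsRight (S₁ S₂ : SkewPartition) (Q : Finset Bead) (b : Bead) : ℕ :=
  doublesRight S₁ S₂ b +
    #{j ∈ {j ∈ beadSet S₁ S₂ | j ∈ Q ↔ j.row = .top} | j.row = b.row ∧ b.col < j.col}

theorem redsRight_add (hQ : Q ⊆ beadSet S₁ S₂) {b : Bead} (hb : b ∈ Q) :
    redsRight S₁ S₂ Q b + #{j ∈ beadSet S₁ S₂ \ Q | j.row = .top} =
      flipExponent S₁ S₂ b + #{j ∈ beadSet S₁ S₂ \ Q | pos b < pos j} := by
  have hsdiff (p : Bead → Prop) [DecidablePred p] :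
      #{j ∈ beadSet S₁ S₂ \ Q | p j} = ∑ j ∈ beadSet S₁ S₂, if j ∉ Q ∧ p j then 1 else 0 := by
    rw [← card_filter, ← filter_filter, filter_notMem_eq_sdiff]
  have hif : (if b.row = .top then beadsRight S₁ S₂ b else 0) =
      ∑ j ∈ beadSet S₁ S₂, if b.row = .top ∧ j.row = b.row ∧ b.col < j.col then 1 else 0 := by
    split_ifs with h <;> simp [h, beadsRight]
  rw [redsRight, flipExponent, hif, hsdiff, hsdiff, filter_filter, card_filter, add_assoc,
    add_assoc, ← sum_add_distrib, ← sum_add_distrib]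
  congr 1
  refine sum_congr rfl fun j hj => ?_
  have hne (hjQ : j ∉ Q) (hrow : j.row = b.row) : j.col ≠ b.col := fun hcol =>
    hjQ (eq_of_row_eq_of_col_eq hj (hQ hb) hrow hcol ▸ hb)
  by_cases hjQ : j ∈ Q
  · obtain ⟨r, k, x⟩ := j
    obtain ⟨r', k', x'⟩ := b
    cases r <;> cases r' <;> simp [hjQ, pos]
  · have := hne hjQ
    clear hif hb hne hj
    obtain ⟨r, k, x⟩ := j
    obtain ⟨r', k', x'⟩ := b
    cases r <;> cases r' <;> simp [hjQ, pos]
    all_goals grind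

theorem flipCoeff_rowState (hw : IsWindow S₁ S₂ L m) (t : R) (row : BeadRow) (i : Fin m) :
    flipCoeff t (rowState S₁ S₂ L row Q) i =
      (-1) ^ beadsRight S₁ S₂ (beadAt S₁ L row i) *
        t ^ redsRight S₁ S₂ Q (beadAt S₁ L row i) := by
  have hbeads (j : Fin m) : (rowState S₁ S₂ L row Q j).1 ≠ (rowState S₁ S₂ L row Q j).2 ↔
      beadAt S₁ L row j ∈ beadSet S₁ S₂ := by
    rw [rowState]
    split_ifs with hs hQ
    · cases row <;> simp [hs, sourceState]
    · cases row <;> simp [hs, sourceState]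
    · rw [beadAt_mem_iff]
  have hreds (j : Fin m) : (rowState S₁ S₂ L row Q j).2 = true ↔
      (beadAt S₁ L row j ∉ beadSet S₁ S₂ ∧ occupied S₂ L row j = true) ∨
        beadAt S₁ L row j ∈ {b ∈ beadSet S₁ S₂ | b ∈ Q ↔ b.row = .top} := by
    rw [rowState, mem_filter]
    split_ifs with hs hQ <;> cases row <;> simp_all [sourceState, beadAt]
  have hdisjoint : Disjoint
      {j ∈ Ioi i | beadAt S₁ L row j ∉ beadSet S₁ S₂ ∧ occupied S₂ L row j = true}
      {j ∈ Ioi i | beadAt S₁ L row j ∈ {b ∈ beadSet S₁ S₂ | b ∈ Q ↔ b.row = .top}} :=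
    disjoint_filter.2 fun j _ hj hj' => hj.1 (mem_filter.1 hj').1
  simp only [flipCoeff_eq_pow, hbeads, hreds]
  rw [filter_or, card_union_of_disjoint hdisjoint, hw.card_filter_double,
    hw.card_filter_beadAt_mem Subset.rfl, hw.card_filter_beadAt_mem (filter_subset _ _)]
  rfl

theorem flipSum_rowState (hw : IsWindow S₁ S₂ L m) (hQ : Q ⊆ beadSet S₁ S₂) (t : R)
    (row : BeadRow) (f : (Fin m → Bool × Bool) → R) :
    flipSum t (sourceState row) (sourceState row).swap (rowState S₁ S₂ L row Q) f =
      ∑ b ∈ Q with b.row = row, (-1) ^ beadsRight S₁ S₂ b * t ^ redsRight S₁ S₂ Q b *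
        f (rowState S₁ S₂ L row (Q.erase b)) := by
  rw [← hw.image_beadAt hQ, sum_image (beadAt_injective row).injOn, flipSum, ← sum_filter]
  simp only [rowState_eq_sourceState_iff hQ]
  refine sum_congr rfl fun i hi => ?_
  rw [flipCoeff_rowState hw, rowState_erase (hQ (mem_filter.1 hi).2)]

/-- The partition function of the strip, where the beads have been recolored in such a way that the
paths enter the strip at the beads of `Q`. -/
def coloredPartitionFunction (S₁ S₂ : SkewPartition) (L m : ℕ) {n : ℕ} (t : R) (x : Fin n → R)
    (Q : Finset Bead) : R :=
  partitionFunction t m x (rowState S₁ S₂ L .bottom Q) (rowState S₁ S₂ L .top Q)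

theorem sum_coloredPartitionFunction_erase (hw : IsWindow S₁ S₂ L m) (hQ : Q ⊆ beadSet S₁ S₂)
    (t : R) (x : Fin n → R) :
    ∑ b ∈ Q, (-1) ^ #{j ∈ beadSet S₁ S₂ | pos b < pos j} * t ^ redsRight S₁ S₂ Q b *
      coloredPartitionFunction S₁ S₂ L m t x (Q.erase b) = 0 := by
  let term (b : Bead) : R := (-1) ^ beadsRight S₁ S₂ b * t ^ redsRight S₁ S₂ Q b *
    coloredPartitionFunction S₁ S₂ L m t x (Q.erase b)
  have hbottom : flipSum t (true, false) (false, true) (rowState S₁ S₂ L .bottom Q)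
      (fun ρ => partitionFunction t m x ρ (rowState S₁ S₂ L .top Q)) =
      ∑ b ∈ Q with b.row = .bottom, term b := by
    refine (flipSum_rowState hw hQ t .bottom _).trans (sum_congr rfl fun b hb => ?_)
    simp only [term, coloredPartitionFunction]
    rw [rowState_erase_of_ne (row := .top) (by simp [(mem_filter.1 hb).2])]
  have htop : flipSum t (false, true) (true, false) (rowState S₁ S₂ L .top Q)
      (fun ρ => partitionFunction t m x (rowState S₁ S₂ L .bottom Q) ρ) =
      ∑ b ∈ Q with b.row = .top, term b := by
    refine (flipSum_rowState hw hQ t .top _).trans (sum_congr rfl fun b hb => ?_)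
    simp only [term, coloredPartitionFunction]
    rw [rowState_erase_of_ne (row := .bottom) (by simp [(mem_filter.1 hb).2])]
  have hcommute : ∑ b ∈ Q with b.row = .bottom, term b = ∑ b ∈ Q with b.row = .top, term b := by
    rw [← hbottom, ← htop, flipSum_partitionFunction]
  rw [← neg_one_pow_mul_eq_zero_iff (n := #{j ∈ beadSet S₁ S₂ | j.row = .top}), mul_sum]
  calc _ = ∑ b ∈ Q, (if b.row = .bottom then 1 else -1) * term b := by
        refine sum_congr rfl fun b hb => ?_
        linear_combination -(t ^ redsRight S₁ S₂ Q b *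
          coloredPartitionFunction S₁ S₂ L m t x (Q.erase b)) *
            neg_one_pow_beadsRight (R := R) (hQ hb)
    _ = ∑ b ∈ Q with b.row = .bottom, term b - ∑ b ∈ Q with b.row = .top, term b := by
        have hrow (b : Bead) : ¬ b.row = .bottom ↔ b.row = .top := by cases b.row <;> simp
        simp only [ite_mul, one_mul, neg_one_mul, sum_ite, sum_neg_distrib, hrow, sub_eq_add_neg]
    _ = 0 := sub_eq_zero.2 hcommute

theorem loweringRelation_coloredPartitionFunction (hw : IsWindow S₁ S₂ L m) (q : Rˣ) (x : Fin n → R)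
    (a : ℕ) : LoweringRelation (q : R) pos (beadSet S₁ S₂) a fun Q =>
      ↑(∏ b ∈ Q, ((-1) ^ #{j ∈ beadSet S₁ S₂ | pos b < pos j} *
        q ^ (-(flipExponent S₁ S₂ b : ℤ)))) *
        coloredPartitionFunction S₁ S₂ L m (q : R) x Q := by
  intro Q hQ _
  set ν : Bead → Rˣ := fun b => (-1) ^ #{j ∈ beadSet S₁ S₂ | pos b < pos j} *
    q ^ (-(flipExponent S₁ S₂ b : ℤ)) with hν
  set K : Rˣ := (∏ b ∈ Q, ν b) * q ^ #{j ∈ beadSet S₁ S₂ \ Q | j.row = .top} with hK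
  have hfactor : ∀ b ∈ Q, q ^ #{j ∈ beadSet S₁ S₂ \ Q | pos b < pos j} * ∏ c ∈ Q.erase b, ν c =
      K * ((-1) ^ #{j ∈ beadSet S₁ S₂ | pos b < pos j} * q ^ redsRight S₁ S₂ Q b) := by
    intro b hb
    have hexp : q ^ #{j ∈ beadSet S₁ S₂ \ Q | j.row = .top} * q ^ redsRight S₁ S₂ Q b =
        q ^ flipExponent S₁ S₂ b * q ^ #{j ∈ beadSet S₁ S₂ \ Q | pos b < pos j} := by
      rw [← pow_add, ← pow_add, add_comm, redsRight_add hQ hb]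
    have hcancel : ν b * ((-1) ^ #{j ∈ beadSet S₁ S₂ | pos b < pos j} *
        q ^ flipExponent S₁ S₂ b) = 1 := by
      rw [hν, mul_mul_mul_comm, ← mul_pow, zpow_neg, zpow_natCast]
      simp
    calc _ = ν b * ((-1) ^ #{j ∈ beadSet S₁ S₂ | pos b < pos j} * q ^ flipExponent S₁ S₂ b) *
          (q ^ #{j ∈ beadSet S₁ S₂ \ Q | pos b < pos j} * ∏ c ∈ Q.erase b, ν c) := by
          rw [hcancel, one_mul]
      _ = (ν b * ∏ c ∈ Q.erase b, ν c) * (-1) ^ #{j ∈ beadSet S₁ S₂ | pos b < pos j} *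
          (q ^ flipExponent S₁ S₂ b * q ^ #{j ∈ beadSet S₁ S₂ \ Q | pos b < pos j}) := by
          ac_rfl
      _ = _ := by
          rw [← hexp, hK, mul_prod_erase Q ν hb]
          ac_rfl
  rw [← mul_zero (K : R), ← sum_coloredPartitionFunction_erase hw hQ (q : R) x, mul_sum]
  refine sum_congr rfl fun b hb => ?_
  have := congrArg (Units.val : Rˣ → R) (hfactor b hb)
  push_cast at this ⊢
  simp only [← mul_assoc] at this ⊢
  rw [this]

end Relation

section LLT

variable {L m : ℕ}

theorem coinvLLT_eq_coloredPartitionFunction (hw : IsWindow S₁ S₂ L m) (n : ℕ) :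
    coinvLLT ![S₁, S₂] n = coloredPartitionFunction S₁ S₂ L m
      (MvPolynomial.C (LaurentPolynomial.T 1)) MvPolynomial.X (sources S₁ S₂) := by
  rw [coinvLLT_eq_partitionFunction ![S₁, S₂] n (Fin.forall_fin_two.2 ⟨hw.len₁, hw.len₂⟩)
    (Fin.forall_fin_two.2 ⟨hw.outer₁, hw.outer₂⟩), coloredPartitionFunction, rowState_sources,
    rowState_sources]
  simp only [← pathState_inner hw.len₁, ← pathState_inner hw.len₂, ← pathState_outer hw.len₁,
    ← pathState_outer hw.len₂]
  rfl

theorem coinvLLT_swap_eq_coloredPartitionFunction (hw : IsWindow S₁ S₂ L m) (n : ℕ) :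
    coinvLLT ![S₂, S₁] n = coloredPartitionFunction S₁ S₂ L m
      (MvPolynomial.C (LaurentPolynomial.T 1)) MvPolynomial.X
      (beadSet S₁ S₂ \ sources S₁ S₂) := by
  rw [coinvLLT_eq_partitionFunction ![S₂, S₁] n (Fin.forall_fin_two.2 ⟨hw.len₂, hw.len₁⟩)
    (Fin.forall_fin_two.2 ⟨hw.outer₂, hw.outer₁⟩), coloredPartitionFunction]
  congr 1 <;> funext c <;> rw [rowState_sdiff, rowState_sources]
  · simp only [← pathState_inner hw.len₁, ← pathState_inner hw.len₂]
    rfl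
  · simp only [← pathState_outer hw.len₁, ← pathState_outer hw.len₂]
    rfl

end LLT

section UnitT

variable (n : ℕ)

/-- The variable `t` as a unit of the ring of the LLT polynomials. -/
noncomputable def unitT : (MvPolynomial (Fin n) (LaurentPolynomial ℤ))ˣ :=
  MonoidHom.toHomUnits ((MvPolynomial.C (σ := Fin n)).toMonoidHom.comp (AddMonoidAlgebra.of ℤ ℤ))
    (Multiplicative.ofAdd 1)

theorem val_unitT_zpow (e : ℤ) : (unitT n ^ e).val = MvPolynomial.C (LaurentPolynomial.T e) := by
  rw [unitT, ← map_zpow, ← ofAdd_zsmul, smul_eq_mul, mul_one]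
  rfl

theorem C_prod_arcWeight (S₁ S₂ : SkewPartition) (M : Finset (Sym2 Bead)) :
    MvPolynomial.C (∏ a ∈ M, arcWeight S₁ S₂ a) =
      (unitT n ^ ∑ a ∈ M, twiceArcExponent S₁ S₂ a / 2).val := by
  rw [zpow_finset_sum, Units.coe_prod, map_prod]
  exact prod_congr rfl fun a _ => (val_unitT_zpow n _).symm

theorem sum_unitT_pow_ne_zero (k : ℕ) : ∑ j ∈ range (k + 1), (unitT n).val ^ j ≠ 0 := by
  have hsum : ∑ j ∈ range (k + 1), (unitT n).val ^ j =
      MvPolynomial.C (Polynomial.toLaurent (∑ j ∈ range (k + 1), Polynomial.X ^ j)) := by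
    rw [map_sum, map_sum]
    refine sum_congr rfl fun j _ => ?_
    rw [Polynomial.toLaurent_X_pow, ← val_unitT_zpow, zpow_natCast, Units.val_pow_eq_pow_val]
  rw [hsum, Ne, MvPolynomial.C_eq_zero, Polynomial.toLaurent_eq_zero]
  intro h
  have heval := congrArg (Polynomial.eval 1) h
  simp [Polynomial.eval_finsetSum] at heval
  lia

end UnitT

end Bead

open Bead in
theorem mainTheorem1 (n : ℕ) (S₁ S₂ : SkewPartition) (M : Finset (Sym2 Bead))
    (hM : Bead.IsMatching S₁ S₂ M ∧ Bead.IsNonCrossing M)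
    (hunique : ∀ M' : Finset (Sym2 Bead),
      Bead.IsMatching S₁ S₂ M' ∧ Bead.IsNonCrossing M' → M' = M) :
    LLTEquivalent (coinvLLT ![S₁, S₂] n) (coinvLLT ![S₂, S₁] n) ∧
    (∀ a ∈ M, Even (Bead.twiceArcExponent S₁ S₂ a)) ∧
    coinvLLT ![S₁, S₂] n =
      MvPolynomial.C (∏ a ∈ M, Bead.arcWeight S₁ S₂ a) * coinvLLT ![S₂, S₁] n := by
  obtain ⟨L, m, hw⟩ := exists_isWindow S₁ S₂
  have hNC := (isNCMatching_iff M).2 hM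
  have hswap : coinvLLT ![S₁, S₂] n =
      (unitT n ^ ∑ a ∈ M, twiceArcExponent S₁ S₂ a / 2).val * coinvLLT ![S₂, S₁] n := by
    have ht : MvPolynomial.C (LaurentPolynomial.T 1) = (unitT n).val := by
      rw [← val_unitT_zpow, zpow_one]
    rw [coinvLLT_eq_coloredPartitionFunction hw, coinvLLT_swap_eq_coloredPartitionFunction hw, ht]
    exact (loweringRelation_coloredPartitionFunction hw (unitT n) MvPolynomial.X _
      ).eq_zpow_mul_of_unique (sum_unitT_pow_ne_zero n) sources_subset injOn_pos hNC
      (fun M' hM' => hunique M' ((isNCMatching_iff M').1 hM')) fun _ hp _ hc =>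
        twiceArcExponent_eq hp hc
  refine ⟨⟨_, by rw [hswap, val_unitT_zpow]⟩, fun a ha => ?_, by rw [hswap, C_prod_arcWeight]⟩
  exact hNC.even_of_eq_arcShift injOn_pos (fun _ hp _ hc => twiceArcExponent_eq hp hc) ha
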